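/- Let $M$ be a smooth $n$-dimensional manifold and $(H,W,h)$ a Kundt$^\infty$ triple on $M$: $h$ is a smooth Riemannian metric, $W$ a smooth one-form and $H$ a smooth function. Let $\nabla$ be the Levi-Civita connection of $h$, write $W_{i;j}=(\nabla_jW)_i$, let $(\ )$ and $[\ ]$ denote symmetrization and antisymmetrization with weight $\tfrac12$, and let $R_{ijlm}=h(\partial_i,R(\partial_l,\partial_m)\partial_j)$ with $R(X,Y)Z=\nabla_X\nabla_YZ-\nabla_Y\nabla_XZ-\nabla_{[X,Y]}Z$. For a constant $\sigma\in\mathbb R$ put $$s_{ij}=W_{(i;j)}-\tfrac12W_iW_j,\qquad a_{ij}=W_{[i;j]},\qquad \alpha_i=\sigma W_i-\tfrac12(s_{ij}+a_{ij})W^j,$$ $$\beta_{ijk}=W^lR_{lijk}-W_ia_{jk}+(s_{i[j}+a_{i[j})W_{k]} .$$ Call a Killing field $\xi$ of $h$ on an open subset of $M$ admissible if $\pounds_\xi a=\pounds_\xi s=\pounds_\xi\alpha=\pounds_\xi\beta=0$ there. Assume that the triple satisfies the conditions CSI$_0$ and CSI$_1$ with constant $\sigma$, that is, $H=\frac{\sigma}{2}+\frac18\|W\|_h^2$,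 and $a,s,\alpha,\beta$ are left-invariant: at every $p\in M$ the values at $p$ of the admissible Killing fields defined near $p$ span $T_pM$. For $p\in M$ let $\mathcal I_p\subset T_p^*M$ be the span of the values at $p$ of all iterated Lie derivatives $\pounds_{\xi_1}\cdots\pounds_{\xi_k}W$, $k\ge1$, with $\xi_1,\dots,\xi_k$ admissible Killing fields on an open neighbourhood of $p$. If $\dim\mathcal I_p=n$ for all $p\in M$, then everywhere on $M$ $$s_{ij}=2\sigma h_{ij},\qquad a_{ij}=0,$$ and $(M,h)$ is locally maximally symmetric, i.e. every point has a connected open neighbourhood on which the Killing fields of $h$ form a vector space of dimension $n(n+1)/2$, with Riemann tensor $$R_{ijlm}=\sigma\,(h_{il}h_{jm}-h_{im}h_{jl}).$$ -/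

import Mathlib

open Set Module
open scoped Manifold ContDiff Topology

noncomputable section

/-! ### Tensor calculus in a coordinate domain

Tensor fields on an open subset of a finite-dimensional vector space `E` (the image of a chart).
`h` is a metric, `W` a one-form, `ξ` a vector field.  A covariant tensor field is a function of the
point and of its vector slots, so `b y u v` is `b_{ij} u^i v^j` at the point `y`. -/

namespace Coord

variable {E : Type*} [NormedAddCommGroup E] [NormedSpace ℝ E]

/-- Lie derivative of a one-form: `ξ^k ∂_k θ_i + θ_k ∂_i ξ^k`. -/
def lie₁ (ξ : E → E) (θ : E → E → ℝ) (y u : E) : ℝ :=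
  fderiv ℝ (fun z => θ z u) y (ξ y) + θ y (fderiv ℝ ξ y u)

/-- Lie derivative of a covariant 2-tensor. -/
def lie₂ (ξ : E → E) (b : E → E → E → ℝ) (y u v : E) : ℝ :=
  fderiv ℝ (fun z => b z u v) y (ξ y) + b y (fderiv ℝ ξ y u) v + b y u (fderiv ℝ ξ y v)

/-- Lie derivative of a covariant 3-tensor. -/
def lie₃ (ξ : E → E) (b : E → E → E → E → ℝ) (y u v w : E) : ℝ :=
  fderiv ℝ (fun z => b z u v w) y (ξ y) + b y (fderiv ℝ ξ y u) v w
    + b y u (fderiv ℝ ξ y v) w + b y u v (fderiv ℝ ξ y w)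

variable (h : E → E →L[ℝ] E →L[ℝ] ℝ) (W : E → E →L[ℝ] ℝ) (σ : ℝ)

/-- Raising an index: the vector `φ^♯` with `h(φ^♯, w) = φ(w)`. -/
def sharp (y : E) (φ : E →L[ℝ] ℝ) : E := (h y).inverse φ

/-- Christoffel symbols of the Levi-Civita connection,
`Γ^k_{ij} = h^{kl} (∂_i h_{jl} + ∂_j h_{il} - ∂_l h_{ij}) / 2`, as the vector `Γ(u, v)`. -/
def christoffel (y u v : E) : E :=
  sharp h y ((1 / 2 : ℝ) •
    (fderiv ℝ h y u v + fderiv ℝ h y v u - fderiv ℝ (fun z => h z u v) y))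

/-- Covariant derivative of a one-form, `W_{i;j} u^i v^j = (∇_v W)(u)`. -/
def covDeriv (y u v : E) : ℝ :=
  fderiv ℝ (fun z => W z u) y v - W y (christoffel h y u v)

/-- The curvature operator `R(u, v) w = ∇_u ∇_v w - ∇_v ∇_u w - ∇_{[u, v]} w`. -/
def curvature (y u v w : E) : E :=
  fderiv ℝ (fun z => christoffel h z v w) y u - fderiv ℝ (fun z => christoffel h z u w) y v
    + christoffel h y u (christoffel h y v w) - christoffel h y v (christoffel h y u w)

/-- The Riemann tensor `R_{ijlm} a^i b^j c^l d^m = h(a, R(c, d) b)`; with this convention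
`W_{i;jk} - W_{i;kj} = W^l R_{lijk}` and round spheres have `R_{1212} > 0`. -/
def riemann (y a b c d : E) : ℝ := h y a (curvature h y c d b)

/-- `s_{ij} = W_{(i;j)} - W_i W_j / 2`. -/
def sTensor (y u v : E) : ℝ :=
  (covDeriv h W y u v + covDeriv h W y v u) / 2 - W y u * W y v / 2

/-- `a_{ij} = W_{[i;j]}`. -/
def aTensor (y u v : E) : ℝ := (covDeriv h W y u v - covDeriv h W y v u) / 2

/-- `α_i = σ W_i - (s_{ij} + a_{ij}) W^j / 2`. -/
def alphaTensor (y u : E) : ℝ :=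
  σ * W y u
    - (sTensor h W y u (sharp h y (W y)) + aTensor h W y u (sharp h y (W y))) / 2

/-- `β_{ijk} = W^l R_{lijk} - W_i a_{jk} + (s_{i[j} + a_{i[j}) W_{k]}`. -/
def betaTensor (y u v w : E) : ℝ :=
  riemann h y (sharp h y (W y)) u v w - W y u * aTensor h W y v w
    + ((sTensor h W y u v + aTensor h W y u v) * W y w
      - (sTensor h W y u w + aTensor h W y u w) * W y v) / 2

end Coord

/-! ### Fields on a manifold and their coordinate expressions -/

section Manifold

variable {n : ℕ} {M : Type*} [TopologicalSpace M] [ChartedSpace (EuclideanSpace ℝ (Fin n)) M]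

/-- A chart of `M`; below, `e` always ranges over the maximal smooth atlas. -/
abbrev ChartOf (n : ℕ) (M : Type*) [TopologicalSpace M] :=
  OpenPartialHomeomorph M (EuclideanSpace ℝ (Fin n))

/-- (Rough) vector fields on `M`. -/
abbrev VField (n : ℕ) (M : Type*) [TopologicalSpace M]
    [ChartedSpace (EuclideanSpace ℝ (Fin n)) M] :=
  Π x : M, TangentSpace (𝓡 n) x

/-- (Rough) one-forms on `M`. -/
abbrev OneForm (n : ℕ) (M : Type*) [TopologicalSpace M]
    [ChartedSpace (EuclideanSpace ℝ (Fin n)) M] :=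
  Π x : M, TangentSpace (𝓡 n) x →L[ℝ] ℝ

/-- Smooth Riemannian metrics on `M`. -/
abbrev RMetric (n : ℕ) (M : Type*) [TopologicalSpace M]
    [ChartedSpace (EuclideanSpace ℝ (Fin n)) M] [IsManifold (𝓡 n) ∞ M] :=
  Bundle.ContMDiffRiemannianMetric (𝓡 n) ∞ (EuclideanSpace ℝ (Fin n))
    (fun x : M => TangentSpace (𝓡 n) x)

/-- The vector field `ξ` in the coordinates of the chart `e`. -/
def fieldIn (e : ChartOf n M) (ξ : VField n M) (y : EuclideanSpace ℝ (Fin n)) :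
    EuclideanSpace ℝ (Fin n) :=
  VectorField.mpullback (𝓡 n) (𝓡 n) e.symm ξ y

/-- The one-form `θ` in the coordinates of the chart `e`, i.e. its pullback under `e⁻¹`. -/
def formIn (e : ChartOf n M) (θ : OneForm n M) (y : EuclideanSpace ℝ (Fin n)) :
    EuclideanSpace ℝ (Fin n) →L[ℝ] ℝ :=
  (θ (e.symm y)).comp (mfderiv (𝓡 n) (𝓡 n) e.symm y)

/-- The metric `h` in the coordinates of the chart `e`, i.e. its pullback under `e⁻¹`. -/
def metricIn [IsManifold (𝓡 n) ∞ M] (e : ChartOf n M) (h : RMetric n M)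
    (y : EuclideanSpace ℝ (Fin n)) :
    EuclideanSpace ℝ (Fin n) →L[ℝ] EuclideanSpace ℝ (Fin n) →L[ℝ] ℝ :=
  let g : EuclideanSpace ℝ (Fin n) →L[ℝ] EuclideanSpace ℝ (Fin n) →L[ℝ] ℝ := h.inner (e.symm y)
  let D : EuclideanSpace ℝ (Fin n) →L[ℝ] EuclideanSpace ℝ (Fin n) :=
    mfderiv (𝓡 n) (𝓡 n) e.symm y
  g.bilinearComp D D

/-- `P e y` holds at every point of `U`, in the coordinates of every smooth chart. -/
def InCharts (U : Set M) (P : ChartOf n M → EuclideanSpace ℝ (Fin n) → Prop) : Prop :=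
  ∀ e ∈ IsManifold.maximalAtlas (𝓡 n) ∞ M, ∀ y ∈ e.target, e.symm y ∈ U → P e y

/-- On `U`, the one-form `v` is the Lie derivative of `θ` along `ξ`. -/
def IsLieDeriv (U : Set M) (ξ : VField n M) (θ v : OneForm n M) : Prop :=
  InCharts U fun e y => ∀ u,
    formIn e v y u = Coord.lie₁ (fieldIn e ξ) (fun z a => formIn e θ z a) y u

variable [IsManifold (𝓡 n) ∞ M]

/-- `ξ` is a smooth vector field on the open set `U`. -/
def IsSmoothField (U : Set M) (ξ : VField n M) : Prop :=
  ContMDiffOn (𝓡 n) ((𝓡 n).prod (𝓡 n)) ∞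
    (fun x => (⟨x, ξ x⟩ : Bundle.TotalSpace (EuclideanSpace ℝ (Fin n))
      (fun x : M => TangentSpace (𝓡 n) x))) U

/-- `ξ` is a (smooth) Killing vector field of `h` on the open set `U`. -/
def IsKilling (h : RMetric n M) (U : Set M) (ξ : VField n M) : Prop :=
  IsSmoothField U ξ ∧ InCharts U fun e y => ∀ u v,
    Coord.lie₂ (fieldIn e ξ) (fun z a b => metricIn e h z a b) y u v = 0

/-- `(M, h)` is locally maximally symmetric: every point has a connected open neighbourhood `U`
on which the Killing fields form a space of the maximal dimension `n (n + 1) / 2`.  (A field on `U`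
is represented by its extension by zero.) -/
def IsLocallyMaximallySymmetric (h : RMetric n M) : Prop :=
  ∀ p : M, ∃ U : Set M, IsOpen U ∧ p ∈ U ∧ IsConnected U ∧
    finrank ℝ (Submodule.span ℝ
      {ξ : VField n M | IsKilling h U ξ ∧ ∀ x, x ∉ U → ξ x = 0}) = n * (n + 1) / 2

variable (n M) in
/-- A Kundt^∞ triple `(H, W, h)` on `M`: a smooth function, a smooth one-form and a Riemannian
metric. -/
structure KundtTriple where
  H : M → ℝ
  W : OneForm n M
  h : RMetric n M
  smooth_H : ContMDiff (𝓡 n) 𝓘(ℝ, ℝ) ∞ H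
  smooth_W : ContMDiff (𝓡 n) ((𝓡 n).prod 𝓘(ℝ, EuclideanSpace ℝ (Fin n) →L[ℝ] ℝ)) ∞
    (fun x => (⟨x, W x⟩ : Bundle.TotalSpace (EuclideanSpace ℝ (Fin n) →L[ℝ] ℝ)
      (fun x : M => TangentSpace (𝓡 n) x →L[ℝ] ℝ)))

namespace KundtTriple

variable (T : KundtTriple n M) (σ : ℝ)

/-- `ξ` is a Killing field of `h` on `U` under which `a`, `s`, `α` and `β` are invariant. -/
def IsSymmetry (U : Set M) (ξ : VField n M) : Prop :=
  IsKilling T.h U ξ ∧ InCharts U fun e y =>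
    (∀ u v, Coord.lie₂ (fieldIn e ξ)
      (Coord.aTensor (metricIn e T.h) (formIn e T.W)) y u v = 0) ∧
    (∀ u v, Coord.lie₂ (fieldIn e ξ)
      (Coord.sTensor (metricIn e T.h) (formIn e T.W)) y u v = 0) ∧
    (∀ u, Coord.lie₁ (fieldIn e ξ)
      (Coord.alphaTensor (metricIn e T.h) (formIn e T.W) σ) y u = 0) ∧
    (∀ u v w, Coord.lie₃ (fieldIn e ξ)
      (Coord.betaTensor (metricIn e T.h) (formIn e T.W)) y u v w = 0)

/-- The conditions CSI₀ and CSI₁ with constant `σ`: one has `H = σ / 2 + ‖W‖² / 8`, and the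
tensors `a`, `s`, `α`, `β` are left-invariant, i.e. invariant under local Killing fields of `h`
which span the tangent space at every point. -/
structure IsCSI : Prop where
  H_eq : InCharts (univ : Set M) fun e y =>
    T.H (e.symm y) = σ / 2
      + formIn e T.W y (Coord.sharp (metricIn e T.h) y (formIn e T.W y)) / 8
  transitive : ∀ p : M, Submodule.span ℝ
    {X : TangentSpace (𝓡 n) p | ∃ U : Set M, IsOpen U ∧ p ∈ U ∧
      ∃ ξ : VField n M, T.IsSymmetry σ U ξ ∧ ξ p = X} = ⊤

/-- `iterLie T σ U k` is the set of `k`-fold iterated Lie derivatives of `W`, on `U`, along the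
Killing fields above. -/
def iterLie (U : Set M) : ℕ → Set (OneForm n M)
  | 0 => {T.W}
  | k + 1 => {v | ∃ w ∈ iterLie U k, ∃ ξ, T.IsSymmetry σ U ξ ∧ IsLieDeriv U ξ w v}

/-- The subspace of the cotangent space at `p` spanned by the values at `p` of all iterated Lie
derivatives of `W` of order at least one along local Killing fields defined near `p`. -/
def lieSpan (p : M) : Submodule ℝ (TangentSpace (𝓡 n) p →L[ℝ] ℝ) :=
  Submodule.span ℝ {θ | ∃ U : Set M, IsOpen U ∧ p ∈ U ∧
    ∃ k : ℕ, ∃ v ∈ T.iterLie σ U (k + 1), v p = θ}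

end KundtTriple

end Manifold

end

open Set Module
open scoped Manifold ContDiff Topology

set_option maxSynthPendingDepth 3

noncomputable section

namespace Coord

variable {E : Type*} [NormedAddCommGroup E] [NormedSpace ℝ E]
  {F : Type*} [NormedAddCommGroup F] [NormedSpace ℝ F]
  {G : Type*} [NormedAddCommGroup G] [NormedSpace ℝ G]

/-! ### Calculus preliminaries -/

/-! Put T = s + a. Up to the term in σ, both α and β are linear expressions in W whose coefficients
are built from h, T and the curvature. An admissible Killing field preserves all of these, so Lie
differentiating α or β gives the same expression with W replaced by its Lie derivative
(`lie_alphaOp`, `lie_betaOp`). Invariance of α and β therefore puts every iterated Lie derivative of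
W, of order at least one, into the kernel of the two linear operators. If these derivatives span the
cotangent space, both operators vanish on every covector. The first then gives T = 2σh, that is s =
2σh and a = 0, and the second becomes the formula for the Riemann tensor (`tTensor_eq_of_span`,
`curvature_of_span`).

Maximal symmetry is obtained from solutions of ψ_{;ij} = -σψh_{ij}, without integrating the constant
curvature condition. Since T = 2σh is symmetric, W is closed, and locally W = -2 d(log φ) for a
positive solution φ (`exists_potential`). Killing fields map solutions to solutions, so every
iterated Lie derivative of W is a combination of forms ψ₁dψ₂ - ψ₂dψ₁ with functions as coefficients
(`IsIterLie.isPairForm`). At a point p the value of such a form is the differential of a solution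
vanishing at p. The spanning hypothesis thus realizes all jets (0, θ), and φ(p) ≠ 0 supplies the
remaining one, so solutions take arbitrary values and differentials at p (`jets_eq_top`).

For two solutions, ψ₁∇ψ₂ - ψ₂∇ψ₁ is a Killing field, and the solutions found produce every
admissible one-jet of a Killing field at p. Conversely, on a convex domain a Killing field is
determined by its one-jet, by Grönwall's inequality along segments. The dimension is then n +
n(n-1)/2 (`finrank_killingSpace`). The count is carried out on a coordinate ball and transported to
M. -/

theorem contDiffAt_fderiv {f : E → F} {y : E} (hf : ContDiffAt ℝ ∞ f y) :
    ContDiffAt ℝ ∞ (fderiv ℝ f) y :=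
  hf.fderiv_right (by simp)

theorem differentiableAt_of_smooth {f : E → F} {y : E} (hf : ContDiffAt ℝ ∞ f y) :
    DifferentiableAt ℝ f y :=
  hf.differentiableAt (by simp)

theorem fderiv_fderiv_comm {f : E → F} {y : E} (hf : ContDiffAt ℝ ∞ f y) (u v : E) :
    fderiv ℝ (fderiv ℝ f) y u v = fderiv ℝ (fderiv ℝ f) y v u :=
  hf.isSymmSndFDerivAt (by simp only [minSmoothness_of_isRCLikeNormedField]; exact WithTop.coe_le_coe.2 le_top) u v

theorem fderiv_clm_apply_apply {A : E → F →L[ℝ] G} {x : E → F} {y : E}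
    (hA : DifferentiableAt ℝ A y) (hx : DifferentiableAt ℝ x y) (w : E) :
    fderiv ℝ (fun z => A z (x z)) y w = fderiv ℝ A y w (x y) + A y (fderiv ℝ x y w) := by
  rw [fderiv_clm_apply hA hx]
  simp [add_comm]

theorem fderiv_clm_apply_const {A : E → F →L[ℝ] G} {y : E}
    (hA : DifferentiableAt ℝ A y) (x : F) (w : E) :
    fderiv ℝ (fun z => A z x) y w = fderiv ℝ A y w x := by
  rw [fderiv_clm_apply_apply hA (differentiableAt_const x)]
  simp

theorem fderiv_clm_apply₂_const {A : E → E →L[ℝ] F →L[ℝ] G} {y : E}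
    (hA : DifferentiableAt ℝ A y) (u : E) (v : F) (w : E) :
    fderiv ℝ (fun z => A z u v) y w = fderiv ℝ A y w u v := by
  rw [fderiv_clm_apply_const (hA.clm_apply (differentiableAt_const u)) v,
    fderiv_clm_apply_const hA]

theorem fderiv_clm_apply₂ {A : E → E →L[ℝ] F →L[ℝ] G} {u : E → E} {v : E → F} {y : E}
    (hA : DifferentiableAt ℝ A y) (hu : DifferentiableAt ℝ u y) (hv : DifferentiableAt ℝ v y)
    (w : E) :
    fderiv ℝ (fun z => A z (u z) (v z)) y w
      = fderiv ℝ A y w (u y) (v y) + A y (fderiv ℝ u y w) (v y) + A y (u y) (fderiv ℝ v y w) := by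
  rw [fderiv_clm_apply_apply (hA.clm_apply hu) hv, fderiv_clm_apply_apply hA hu]
  simp

theorem eventuallyEq_of_eqOn {X Y : Type*} [TopologicalSpace X] {O : Set X} {x : X} {f g : X → Y}
    (hO : IsOpen O) (hx : x ∈ O) (hfg : ∀ z ∈ O, f z = g z) : f =ᶠ[𝓝 x] g := by
  filter_upwards [hO.mem_nhds hx] with z hz using hfg z hz

theorem fderiv_eq_zero_of_eventually_eq_zero {f : E → F} {y : E} (hf : f =ᶠ[𝓝 y] 0) :
    fderiv ℝ f y = 0 := by
  rw [hf.fderiv_eq]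
  exact fderiv_const_apply (0 : F)

/-! ### Metrics and Christoffel symbols -/

/-- `h` is a smooth Riemannian metric on the open set `Ω`. -/
structure IsMetricOn (h : E → E →L[ℝ] E →L[ℝ] ℝ) (Ω : Set E) : Prop where
  isOpen : IsOpen Ω
  smooth : ∀ y ∈ Ω, ContDiffAt ℝ ∞ h y
  symm : ∀ y ∈ Ω, ∀ u v, h y u v = h y v u
  pos : ∀ y ∈ Ω, ∀ u, u ≠ 0 → 0 < h y u u

/-- The Christoffel symbols of the first kind as a bilinear map. -/
def christoffelLower (h : E → E →L[ℝ] E →L[ℝ] ℝ) (y : E) : E →L[ℝ] E →L[ℝ] E →L[ℝ] ℝ :=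
  (1 / 2 : ℝ) • (fderiv ℝ h y + (fderiv ℝ h y).flip
    - ((ContinuousLinearMap.flipₗᵢ ℝ E E ℝ : (E →L[ℝ] E →L[ℝ] ℝ) →L[ℝ] (E →L[ℝ] E →L[ℝ] ℝ))).comp
        (fderiv ℝ h y).flip)

/-- The Christoffel symbols as a bilinear map. -/
def chr (h : E → E →L[ℝ] E →L[ℝ] ℝ) (y : E) : E →L[ℝ] E →L[ℝ] E :=
  (ContinuousLinearMap.compL ℝ E (E →L[ℝ] ℝ) E (h y).inverse).comp (christoffelLower h y)

theorem christoffelLower_apply (h : E → E →L[ℝ] E →L[ℝ] ℝ) (y u v w : E) :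
    christoffelLower h y u v w
      = (fderiv ℝ h y u v w + fderiv ℝ h y v u w - fderiv ℝ h y w u v) / 2 := by
  simp [christoffelLower]; ring

theorem chr_apply (h : E → E →L[ℝ] E →L[ℝ] ℝ) (y u v : E) :
    chr h y u v = sharp h y (christoffelLower h y u v) := rfl

theorem contDiffAt_christoffelLower {h : E → E →L[ℝ] E →L[ℝ] ℝ} {y : E}
    (hh : ContDiffAt ℝ ∞ h y) : ContDiffAt ℝ ∞ (christoffelLower h) y := by
  have h1 := contDiffAt_fderiv hh
  have h2 : ContDiffAt ℝ ∞ (fun z => (fderiv ℝ h z).flip) y :=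
    ((ContinuousLinearMap.flipₗᵢ ℝ E E (E →L[ℝ] ℝ)).contDiff.contDiffAt).comp y h1
  exact ((h1.add h2).sub (contDiffAt_const.clm_comp h2)).const_smul (1 / 2 : ℝ)

variable {h : E → E →L[ℝ] E →L[ℝ] ℝ} {Ω : Set E}

namespace IsMetricOn

theorem mono (H : IsMetricOn h Ω) {O : Set E} (hO : IsOpen O) (hs : O ⊆ Ω) : IsMetricOn h O :=
  ⟨hO, fun y hy => H.smooth y (hs hy), fun y hy => H.symm y (hs hy), fun y hy => H.pos y (hs hy)⟩

/-- Positivity applied to the difference of the two vectors. It allows identities for `chr` and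
`sharp` to be checked with the index lowered, so that the inverse metric never has to be
differentiated explicitly. -/
theorem ext_vec (H : IsMetricOn h Ω) {y : E} (hy : y ∈ Ω) {u v : E}
    (huv : ∀ w, h y u w = h y v w) : u = v := by
  by_contra hne
  have := H.pos y hy (u - v) (sub_ne_zero.2 hne)
  have h2 := huv (u - v)
  rw [← sub_eq_zero, ← sub_apply, ← map_sub] at h2
  exact this.ne' h2

/-- `christoffel` takes the vectors as bare arguments, whereas `chr` is one smooth map into bilinear
maps and can be differentiated as such. Later computations use `chr`. -/
theorem christoffel_eq (H : IsMetricOn h Ω) {y : E} (hy : y ∈ Ω) (u v : E) :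
    christoffel h y u v = chr h y u v := by
  rw [chr_apply, christoffel]
  congr 1
  ext w
  simp only [christoffelLower_apply, smul_apply, sub_apply,
    add_apply,
    fderiv_clm_apply₂_const (differentiableAt_of_smooth (H.smooth y hy)), smul_eq_mul]
  ring

theorem fderiv_symm (H : IsMetricOn h Ω) {y : E} (hy : y ∈ Ω) (w u v : E) :
    fderiv ℝ h y w u v = fderiv ℝ h y w v u := by
  have hd := differentiableAt_of_smooth (H.smooth y hy)
  rw [← fderiv_clm_apply₂_const hd, ← fderiv_clm_apply₂_const hd]
  congr 1
  apply Filter.EventuallyEq.fderiv_eq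
  filter_upwards [H.isOpen.mem_nhds hy] with z hz using H.symm z hz u v

variable [FiniteDimensional ℝ E]

theorem exists_equiv (H : IsMetricOn h Ω) {y : E} (hy : y ∈ Ω) :
    ∃ e : E ≃L[ℝ] (E →L[ℝ] ℝ), (e : E →L[ℝ] E →L[ℝ] ℝ) = h y := by
  have hinj : Function.Injective (h y : E →ₗ[ℝ] (E →L[ℝ] ℝ)) := fun u v huv =>
    H.ext_vec hy fun w => congrArg (fun l : E →L[ℝ] ℝ => l w) huv
  have hdim : finrank ℝ E = finrank ℝ (E →L[ℝ] ℝ) := by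
    rw [← (LinearMap.toContinuousLinearMap : (E →ₗ[ℝ] ℝ) ≃ₗ[ℝ] (E →L[ℝ] ℝ)).finrank_eq]
    exact (Subspace.dual_finrank_eq (K := ℝ) (V := E)).symm
  refine ⟨(LinearEquiv.ofInjectiveOfFinrankEq (h y : E →ₗ[ℝ] (E →L[ℝ] ℝ)) hinj
    hdim).toContinuousLinearEquiv, ?_⟩
  ext u v
  rfl

theorem apply_sharp (H : IsMetricOn h Ω) {y : E} (hy : y ∈ Ω) (φ : E →L[ℝ] ℝ) :
    h y (sharp h y φ) = φ := by
  obtain ⟨e, he⟩ := H.exists_equiv hy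
  rw [sharp, ← he, ContinuousLinearMap.inverse_equiv]
  simp

theorem sharp_apply (H : IsMetricOn h Ω) {y : E} (hy : y ∈ Ω) (u : E) :
    sharp h y (h y u) = u :=
  H.ext_vec hy fun w => by rw [H.apply_sharp hy]

theorem contDiffAt_inverse (H : IsMetricOn h Ω) {y : E} (hy : y ∈ Ω) :
    ContDiffAt ℝ ∞ (fun z => (h z).inverse) y := by
  obtain ⟨e, he⟩ := H.exists_equiv hy
  have := contDiffAt_map_inverse (n := ∞) (𝕜 := ℝ) e
  rw [he] at this
  exact this.comp y (H.smooth y hy)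

theorem contDiffAt_sharp (H : IsMetricOn h Ω) {y : E} (hy : y ∈ Ω) {θ : E → E →L[ℝ] ℝ}
    (hθ : ContDiffAt ℝ ∞ θ y) : ContDiffAt ℝ ∞ (fun z => sharp h z (θ z)) y :=
  (H.contDiffAt_inverse hy).clm_apply hθ

theorem contDiffAt_chr (H : IsMetricOn h Ω) {y : E} (hy : y ∈ Ω) :
    ContDiffAt ℝ ∞ (chr h) y := by
  have h1 : ContDiffAt ℝ ∞ (fun z => ContinuousLinearMap.compL ℝ E (E →L[ℝ] ℝ) E (h z).inverse) y :=
    (ContinuousLinearMap.compL ℝ E (E →L[ℝ] ℝ) E).contDiff.contDiffAt.comp y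
      (H.contDiffAt_inverse hy)
  exact h1.clm_comp (contDiffAt_christoffelLower (H.smooth y hy))

theorem apply_chr (H : IsMetricOn h Ω) {y : E} (hy : y ∈ Ω) (u v w : E) :
    h y (chr h y u v) w
      = (fderiv ℝ h y u v w + fderiv ℝ h y v u w - fderiv ℝ h y w u v) / 2 := by
  rw [chr_apply, H.apply_sharp hy, christoffelLower_apply]

theorem chr_symm (H : IsMetricOn h Ω) {y : E} (hy : y ∈ Ω) (u v : E) :
    chr h y u v = chr h y v u :=
  H.ext_vec hy fun w => by
    rw [H.apply_chr hy, H.apply_chr hy, H.fderiv_symm hy w u v]; ring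

theorem curvature_eq (H : IsMetricOn h Ω) {y : E} (hy : y ∈ Ω) (u v w : E) :
    curvature h y u v w = fderiv ℝ (chr h) y u v w - fderiv ℝ (chr h) y v u w
      + chr h y u (chr h y v w) - chr h y v (chr h y u w) := by
  have hd := differentiableAt_of_smooth (H.contDiffAt_chr hy)
  have key : ∀ a b : E, fderiv ℝ (fun z => christoffel h z a b) y
      = fderiv ℝ (fun z => chr h z a b) y := fun a b => by
    apply Filter.EventuallyEq.fderiv_eq
    filter_upwards [H.isOpen.mem_nhds hy] with z hz using H.christoffel_eq hz a b
  rw [curvature, key, key, fderiv_clm_apply₂_const hd, fderiv_clm_apply₂_const hd,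
    H.christoffel_eq hy, H.christoffel_eq hy, H.christoffel_eq hy, H.christoffel_eq hy]

end IsMetricOn

end Coord

namespace Coord

variable {E : Type*} [NormedAddCommGroup E] [NormedSpace ℝ E]
  {h : E → E →L[ℝ] E →L[ℝ] ℝ} {O : Set E} {ξ : E → E} {y : E}

/-! ### Killing fields and invariance of the curvature -/

/-- `ξ` is a smooth Killing field of `h` on `O`. -/
structure IsKillingOn (h : E → E →L[ℝ] E →L[ℝ] ℝ) (O : Set E) (ξ : E → E) : Prop where
  smooth : ∀ y ∈ O, ContDiffAt ℝ ∞ ξ y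
  lie : ∀ y ∈ O, ∀ u v,
    fderiv ℝ h y (ξ y) u v + h y (fderiv ℝ ξ y u) v + h y u (fderiv ℝ ξ y v) = 0

/-- The Lie derivative of a one-form, as a one-form. -/
def lieForm (ξ : E → E) (w : E → E →L[ℝ] ℝ) (y : E) : E →L[ℝ] ℝ :=
  fderiv ℝ w y (ξ y) + (w y).comp (fderiv ℝ ξ y)

theorem lieForm_apply (ξ : E → E) (w : E → E →L[ℝ] ℝ) (y u : E) :
    lieForm ξ w y u = fderiv ℝ w y (ξ y) u + w y (fderiv ℝ ξ y u) := rfl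

theorem lie₁_eq_lieForm {w : E → E →L[ℝ] ℝ} (hw : ContDiffAt ℝ ∞ w y) (u : E) :
    lie₁ ξ (fun z a => w z a) y u = lieForm ξ w y u := by
  rw [lie₁, fderiv_clm_apply_const (differentiableAt_of_smooth hw), lieForm_apply]

theorem contDiffAt_lieForm {w : E → E →L[ℝ] ℝ} (hξ : ContDiffAt ℝ ∞ ξ y)
    (hw : ContDiffAt ℝ ∞ w y) : ContDiffAt ℝ ∞ (lieForm ξ w) y :=
  ((contDiffAt_fderiv hw).clm_apply hξ).add (hw.clm_comp (contDiffAt_fderiv hξ))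

theorem lieForm_congr {w w' : E → E →L[ℝ] ℝ} (hw : w =ᶠ[𝓝 y] w') :
    lieForm ξ w y = lieForm ξ w' y := by
  rw [lieForm, lieForm, hw.fderiv_eq, hw.eq_of_nhds]

theorem fderiv_eq_zero_of_eqOn (hO : IsOpen O) (hy : y ∈ O) {F : Type*} [NormedAddCommGroup F]
    [NormedSpace ℝ F] {f : E → F} (hf : ∀ z ∈ O, f z = 0) : fderiv ℝ f y = 0 :=
  fderiv_eq_zero_of_eventually_eq_zero (by filter_upwards [hO.mem_nhds hy] with z hz using hf z hz)

namespace IsKillingOn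

theorem mono (K : IsKillingOn h O ξ) {O' : Set E} (hs : O' ⊆ O) : IsKillingOn h O' ξ :=
  ⟨fun y hy => K.smooth y (hs hy), fun y hy => K.lie y (hs hy)⟩

/-- The Killing equation differentiated once more, in the direction `w`; `lie_chr` combines three
permutations of it. -/
theorem fderiv_lie (H : IsMetricOn h O) (K : IsKillingOn h O ξ) (hy : y ∈ O) (w u v : E) :
    fderiv ℝ (fderiv ℝ h) y w (ξ y) u v + fderiv ℝ h y (fderiv ℝ ξ y w) u v
      + (fderiv ℝ h y w (fderiv ℝ ξ y u) v + h y (fderiv ℝ (fderiv ℝ ξ) y w u) v)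
      + (fderiv ℝ h y w u (fderiv ℝ ξ y v) + h y u (fderiv ℝ (fderiv ℝ ξ) y w v)) = 0 := by
  have hh := H.smooth y hy
  have hξ := K.smooth y hy
  have dh := differentiableAt_of_smooth hh
  have dξ := differentiableAt_of_smooth hξ
  have ddh := differentiableAt_of_smooth (contDiffAt_fderiv hh)
  have ddξ := differentiableAt_of_smooth (contDiffAt_fderiv hξ)
  have dc : ∀ a : E, DifferentiableAt ℝ (fun _ : E => a) y := differentiableAt_const
  have h0 := fderiv_eq_zero_of_eqOn H.isOpen hy (fun z hz => K.lie z hz u v)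
  have h1 := congrArg (fun l : E →L[ℝ] ℝ => l w) h0
  have d1 : DifferentiableAt ℝ (fun z => fderiv ℝ h z (ξ z) u v) y :=
    ((ddh.clm_apply dξ).clm_apply (dc u)).clm_apply (dc v)
  have d2 : DifferentiableAt ℝ (fun z => h z (fderiv ℝ ξ z u) v) y :=
    (dh.clm_apply (ddξ.clm_apply (dc u))).clm_apply (dc v)
  have d3 : DifferentiableAt ℝ (fun z => h z u (fderiv ℝ ξ z v)) y :=
    (dh.clm_apply (dc u)).clm_apply (ddξ.clm_apply (dc v))
  have e1 : fderiv ℝ (fun z => fderiv ℝ h z (ξ z) u v) y w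
      = fderiv ℝ (fderiv ℝ h) y w (ξ y) u v + fderiv ℝ h y (fderiv ℝ ξ y w) u v := by
    rw [fderiv_clm_apply_const ((ddh.clm_apply dξ).clm_apply (dc u)),
      fderiv_clm_apply_const (ddh.clm_apply dξ), fderiv_clm_apply_apply ddh dξ]
    rfl
  rw [fderiv_fun_add (d1.fun_add d2) d3, fderiv_fun_add d1 d2] at h1
  simp only [add_apply, zero_apply] at h1
  rw [e1, fderiv_clm_apply₂ dh (ddξ.clm_apply (dc u)) (dc v),
    fderiv_clm_apply₂ dh (dc u) (ddξ.clm_apply (dc v)), fderiv_clm_apply_const ddξ,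
    fderiv_clm_apply_const ddξ] at h1
  simpa using h1

/-- A Killing field preserves the Levi-Civita connection. Christoffel symbols are not tensorial,
hence the second derivative of `ξ`; read the other way, the identity expresses that second
derivative through the one-jet of `ξ`, which is what rigidity needs. -/
theorem lie_chr [FiniteDimensional ℝ E] (H : IsMetricOn h O) (K : IsKillingOn h O ξ) (hy : y ∈ O)
    (u v : E) :
    fderiv ℝ (fderiv ℝ ξ) y u v + fderiv ℝ (chr h) y (ξ y) u v + chr h y (fderiv ℝ ξ y u) v
      + chr h y u (fderiv ℝ ξ y v) - fderiv ℝ ξ y (chr h y u v) = 0 := by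
  have hh := H.smooth y hy
  have dh := differentiableAt_of_smooth hh
  have ddh := differentiableAt_of_smooth (contDiffAt_fderiv hh)
  have dΓ := differentiableAt_of_smooth (H.contDiffAt_chr hy)
  have dc : ∀ a : E, DifferentiableAt ℝ (fun _ : E => a) y := differentiableAt_const
  refine H.ext_vec hy fun w => ?_
  have d1 : ∀ a b c : E, DifferentiableAt ℝ (fun z => fderiv ℝ h z a b c) y := fun a b c =>
    ((ddh.clm_apply (dc a)).clm_apply (dc b)).clm_apply (dc c)
  have e1 : ∀ a b c x : E, fderiv ℝ (fun z => fderiv ℝ h z a b c) y x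
      = fderiv ℝ (fderiv ℝ h) y x a b c := fun a b c x => by
    rw [fderiv_clm_apply₂_const (ddh.clm_apply (dc a)), fderiv_clm_apply_const ddh]
  have h0 : fderiv ℝ (fun z => h z (chr h z u v) w) y (ξ y)
      = (fderiv ℝ (fderiv ℝ h) y (ξ y) u v w + fderiv ℝ (fderiv ℝ h) y (ξ y) v u w
        - fderiv ℝ (fderiv ℝ h) y (ξ y) w u v) * (2⁻¹) := by
    have : (fun z => h z (chr h z u v) w) =ᶠ[𝓝 y] fun z =>
        (fderiv ℝ h z u v w + fderiv ℝ h z v u w - fderiv ℝ h z w u v) * (2⁻¹) := by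
      filter_upwards [H.isOpen.mem_nhds hy] with z hz
      rw [H.apply_chr hz, div_eq_mul_inv]
    rw [this.fderiv_eq, fderiv_mul_const (((d1 _ _ _).fun_add (d1 _ _ _)).fun_sub (d1 _ _ _)),
      fderiv_fun_sub ((d1 _ _ _).fun_add (d1 _ _ _)) (d1 _ _ _),
      fderiv_fun_add (d1 _ _ _) (d1 _ _ _)]
    simp only [smul_apply, sub_apply, add_apply, e1, smul_eq_mul]
    ring
  rw [fderiv_clm_apply₂ dh ((dΓ.clm_apply (dc u)).clm_apply (dc v)) (dc w),
    fderiv_clm_apply₂_const dΓ] at h0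
  simp only [map_add, map_sub, add_apply, sub_apply, map_zero, zero_apply, fderiv_const_apply,
    add_zero] at h0 ⊢
  -- The combination k1 + k2 - k3 repeats the sign pattern of the Christoffel formula, and symmetry
  -- of second derivatives leaves only one second derivative of `ξ`. The Killing equation `k4` at
  -- the vectors Γ(u, v) and `w` accounts for the derivative of the metric used to lower the index.
  have k1 := K.fderiv_lie H hy u v w
  have k2 := K.fderiv_lie H hy v u w
  have k3 := K.fderiv_lie H hy w u v
  have k4 := K.lie y hy (chr h y u v) w
  rw [H.symm y hy v] at k1
  rw [H.symm y hy u] at k2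
  rw [H.symm y hy u] at k3
  have s1 := fderiv_fderiv_comm hh u (ξ y)
  have s2 := fderiv_fderiv_comm hh v (ξ y)
  have s3 := fderiv_fderiv_comm hh w (ξ y)
  rw [s1] at k1
  rw [s2] at k2
  rw [s3] at k3
  have t := fderiv_fderiv_comm (K.smooth y hy)
  rw [t w u] at k3
  rw [t w v] at k3
  rw [t v u] at k2
  have g1 := H.apply_chr hy (fderiv ℝ ξ y u) v w
  have g2 := H.apply_chr hy u (fderiv ℝ ξ y v) w
  have g3 := H.apply_chr hy u v (fderiv ℝ ξ y w)
  have f1 := H.fderiv_symm hy w u (fderiv ℝ ξ y v)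
  have f2 := H.fderiv_symm hy w (fderiv ℝ ξ y u) v
  linarith

theorem fderiv_curvature [FiniteDimensional ℝ E] (H : IsMetricOn h O) (hy : y ∈ O)
    (a b c x : E) :
    DifferentiableAt ℝ (fun z => curvature h z a b c) y ∧
    fderiv ℝ (fun z => curvature h z a b c) y x
      = fderiv ℝ (fderiv ℝ (chr h)) y x a b c - fderiv ℝ (fderiv ℝ (chr h)) y x b a c
        + (fderiv ℝ (chr h) y x a (chr h y b c) + chr h y a (fderiv ℝ (chr h) y x b c))
        - (fderiv ℝ (chr h) y x b (chr h y a c) + chr h y b (fderiv ℝ (chr h) y x a c)) := by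
  have dΓ := differentiableAt_of_smooth (H.contDiffAt_chr hy)
  have ddΓ := differentiableAt_of_smooth (contDiffAt_fderiv (H.contDiffAt_chr hy))
  have dc : ∀ a : E, DifferentiableAt ℝ (fun _ : E => a) y := differentiableAt_const
  have d1 : ∀ a b c : E, DifferentiableAt ℝ (fun z => fderiv ℝ (chr h) z a b c) y := fun a b c =>
    ((ddΓ.clm_apply (dc a)).clm_apply (dc b)).clm_apply (dc c)
  have d2 : ∀ b c : E, DifferentiableAt ℝ (fun z => chr h z b c) y := fun b c =>
    (dΓ.clm_apply (dc b)).clm_apply (dc c)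
  have d3 : ∀ a b c : E, DifferentiableAt ℝ (fun z => chr h z a (chr h z b c)) y := fun a b c =>
    (dΓ.clm_apply (dc a)).clm_apply (d2 b c)
  have e1 : ∀ a b c x : E, fderiv ℝ (fun z => fderiv ℝ (chr h) z a b c) y x
      = fderiv ℝ (fderiv ℝ (chr h)) y x a b c := fun a b c x => by
    rw [fderiv_clm_apply₂_const (ddΓ.clm_apply (dc a)), fderiv_clm_apply_const ddΓ]
  have e3 : ∀ a b c x : E, fderiv ℝ (fun z => chr h z a (chr h z b c)) y x
      = fderiv ℝ (chr h) y x a (chr h y b c) + chr h y a (fderiv ℝ (chr h) y x b c) :=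
    fun a b c x => by
      rw [fderiv_clm_apply₂ dΓ (dc a) (d2 b c), fderiv_clm_apply₂_const dΓ]
      simp
  have this : (fun z => curvature h z a b c) =ᶠ[𝓝 y] fun z =>
      fderiv ℝ (chr h) z a b c - fderiv ℝ (chr h) z b a c
      + chr h z a (chr h z b c) - chr h z b (chr h z a c) := by
    filter_upwards [H.isOpen.mem_nhds hy] with z hz using H.curvature_eq hz a b c
  have d4 := ((d1 a b c).fun_sub (d1 b a c))
  have d5 := (d4.fun_add (d3 a b c)).fun_sub (d3 b a c)
  refine ⟨d5.congr_of_eventuallyEq this, ?_⟩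
  rw [this.fderiv_eq, fderiv_fun_sub (d4.fun_add (d3 a b c)) (d3 b a c),
    fderiv_fun_add d4 (d3 a b c), fderiv_fun_sub (d1 a b c) (d1 b a c)]
  simp only [add_apply, sub_apply, e1, e3]

theorem fderiv_lie_chr [FiniteDimensional ℝ E] (H : IsMetricOn h O) (K : IsKillingOn h O ξ)
    (hy : y ∈ O) (a b c : E) :
    fderiv ℝ (fderiv ℝ (fderiv ℝ ξ)) y a b c
      + (fderiv ℝ (fderiv ℝ (chr h)) y a (ξ y) b c + fderiv ℝ (chr h) y (fderiv ℝ ξ y a) b c)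
      + (fderiv ℝ (chr h) y a (fderiv ℝ ξ y b) c
        + chr h y (fderiv ℝ (fderiv ℝ ξ) y a b) c)
      + (fderiv ℝ (chr h) y a b (fderiv ℝ ξ y c)
        + chr h y b (fderiv ℝ (fderiv ℝ ξ) y a c))
      - (fderiv ℝ (fderiv ℝ ξ) y a (chr h y b c)
        + fderiv ℝ ξ y (fderiv ℝ (chr h) y a b c)) = 0 := by
  have hξ := K.smooth y hy
  have dξ := differentiableAt_of_smooth hξ
  have ddξ := differentiableAt_of_smooth (contDiffAt_fderiv hξ)
  have dddξ := differentiableAt_of_smooth (contDiffAt_fderiv (contDiffAt_fderiv hξ))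
  have dΓ := differentiableAt_of_smooth (H.contDiffAt_chr hy)
  have ddΓ := differentiableAt_of_smooth (contDiffAt_fderiv (H.contDiffAt_chr hy))
  have dc : ∀ a : E, DifferentiableAt ℝ (fun _ : E => a) y := differentiableAt_const
  have h0 := fderiv_eq_zero_of_eqOn H.isOpen hy (fun z hz => K.lie_chr H hz b c)
  have h1 := congrArg (fun l : E →L[ℝ] E => l a) h0
  have dΓbc := (dΓ.clm_apply (dc b)).clm_apply (dc c)
  have d1 : DifferentiableAt ℝ (fun z => fderiv ℝ (fderiv ℝ ξ) z b c) y :=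
    (dddξ.clm_apply (dc b)).clm_apply (dc c)
  have d2 : DifferentiableAt ℝ (fun z => fderiv ℝ (chr h) z (ξ z) b c) y :=
    ((ddΓ.clm_apply dξ).clm_apply (dc b)).clm_apply (dc c)
  have d3 : DifferentiableAt ℝ (fun z => chr h z (fderiv ℝ ξ z b) c) y :=
    (dΓ.clm_apply (ddξ.clm_apply (dc b))).clm_apply (dc c)
  have d4 : DifferentiableAt ℝ (fun z => chr h z b (fderiv ℝ ξ z c)) y :=
    (dΓ.clm_apply (dc b)).clm_apply (ddξ.clm_apply (dc c))
  have d5 : DifferentiableAt ℝ (fun z => fderiv ℝ ξ z (chr h z b c)) y := ddξ.clm_apply dΓbc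
  have e2 : fderiv ℝ (fun z => fderiv ℝ (chr h) z (ξ z) b c) y a
      = fderiv ℝ (fderiv ℝ (chr h)) y a (ξ y) b c
        + fderiv ℝ (chr h) y (fderiv ℝ ξ y a) b c := by
    rw [fderiv_clm_apply₂_const (ddΓ.clm_apply dξ), fderiv_clm_apply_apply ddΓ dξ]
    rfl
  have d12 := d1.fun_add d2
  have d123 := d12.fun_add d3
  have d1234 := d123.fun_add d4
  rw [fderiv_fun_sub d1234 d5, fderiv_fun_add d123 d4, fderiv_fun_add d12 d3,
    fderiv_fun_add d1 d2] at h1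
  simp only [add_apply, sub_apply, zero_apply] at h1
  rw [e2, fderiv_clm_apply₂_const dddξ, fderiv_clm_apply₂ dΓ (ddξ.clm_apply (dc b)) (dc c),
    fderiv_clm_apply₂ dΓ (dc b) (ddξ.clm_apply (dc c)), fderiv_clm_apply_apply ddξ dΓbc,
    fderiv_clm_apply_const ddξ, fderiv_clm_apply_const ddξ, fderiv_clm_apply₂_const dΓ] at h1
  simpa using h1

/-- Antisymmetrizing the derivative of `lie_chr` in `a` and `b` removes the third derivatives of
`ξ`. The remaining second derivatives of `ξ` are eliminated by `lie_chr` itself, inserted into and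
applied to the terms quadratic in Γ. -/
theorem lie_curvature [FiniteDimensional ℝ E] (H : IsMetricOn h O) (K : IsKillingOn h O ξ)
    (hy : y ∈ O) (a b c : E) :
    fderiv ℝ (fun z => curvature h z a b c) y (ξ y)
      + curvature h y (fderiv ℝ ξ y a) b c + curvature h y a (fderiv ℝ ξ y b) c
      + curvature h y a b (fderiv ℝ ξ y c) - fderiv ℝ ξ y (curvature h y a b c) = 0 := by
  have hξ := K.smooth y hy
  have hΓ := H.contDiffAt_chr hy
  have k1 := K.fderiv_lie_chr H hy a b c
  have k2 := K.fderiv_lie_chr H hy b a c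
  have l1 := congrArg (chr h y a) (K.lie_chr H hy b c)
  have l2 := congrArg (chr h y b) (K.lie_chr H hy a c)
  have l3 := K.lie_chr H hy a (chr h y b c)
  have l4 := K.lie_chr H hy b (chr h y a c)
  rw [fderiv_fderiv_comm (contDiffAt_fderiv hξ) a b, fderiv_fderiv_comm hξ a b,
    fderiv_fderiv_comm hΓ a (ξ y)] at k1
  rw [fderiv_fderiv_comm hΓ b (ξ y)] at k2
  rw [(fderiv_curvature H hy a b c (ξ y)).2, H.curvature_eq hy, H.curvature_eq hy,
    H.curvature_eq hy, H.curvature_eq hy]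
  simp only [map_add, map_sub, map_zero] at l1 l2 ⊢
  linear_combination (norm := module) k1 - k2 + l1 - l2 + l3 - l4

end IsKillingOn

end Coord

namespace Coord

variable {E : Type*} [NormedAddCommGroup E] [NormedSpace ℝ E]
  {h : E → E →L[ℝ] E →L[ℝ] ℝ} {O : Set E} {ξ : E → E} {y : E}
  {W w : E → E →L[ℝ] ℝ} {σ : ℝ}

/-! ### The tensor `s + a` and the operators attached to `α` and `β` -/

/-- The covariant derivative of a one-form as a bilinear form. -/
def cov (h : E → E →L[ℝ] E →L[ℝ] ℝ) (W : E → E →L[ℝ] ℝ) (y : E) : E →L[ℝ] E →L[ℝ] ℝ :=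
  (fderiv ℝ W y).flip - (ContinuousLinearMap.compL ℝ E E ℝ (W y)).comp (chr h y)

theorem cov_apply (h : E → E →L[ℝ] E →L[ℝ] ℝ) (W : E → E →L[ℝ] ℝ) (y u v : E) :
    cov h W y u v = fderiv ℝ W y v u - W y (chr h y u v) := rfl

/-- The tensor `s + a`, that is, `W_{i;j} - W_i W_j / 2`. -/
def tTensor (h : E → E →L[ℝ] E →L[ℝ] ℝ) (W : E → E →L[ℝ] ℝ) (y : E) : E →L[ℝ] E →L[ℝ] ℝ :=
  cov h W y - (1 / 2 : ℝ) • (W y).smulRight (W y)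

theorem tTensor_apply (h : E → E →L[ℝ] E →L[ℝ] ℝ) (W : E → E →L[ℝ] ℝ) (y u v : E) :
    tTensor h W y u v = fderiv ℝ W y v u - W y (chr h y u v) - W y u * W y v / 2 := by
  simp [tTensor, cov_apply]; ring

theorem covDeriv_eq (H : IsMetricOn h O) (hW : ContDiffAt ℝ ∞ W y) (hy : y ∈ O) (u v : E) :
    covDeriv h W y u v = cov h W y u v := by
  rw [covDeriv, cov_apply, fderiv_clm_apply_const (differentiableAt_of_smooth hW),
    H.christoffel_eq hy]

theorem sTensor_eq (H : IsMetricOn h O) (hW : ContDiffAt ℝ ∞ W y) (hy : y ∈ O) (u v : E) :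
    sTensor h W y u v = (tTensor h W y u v + tTensor h W y v u) / 2 := by
  rw [sTensor, covDeriv_eq H hW hy, covDeriv_eq H hW hy, tTensor_apply, tTensor_apply, cov_apply,
    cov_apply]
  ring

theorem aTensor_eq (H : IsMetricOn h O) (hW : ContDiffAt ℝ ∞ W y) (hy : y ∈ O) (u v : E) :
    aTensor h W y u v = (tTensor h W y u v - tTensor h W y v u) / 2 := by
  rw [aTensor, covDeriv_eq H hW hy, covDeriv_eq H hW hy, tTensor_apply, tTensor_apply, cov_apply,
    cov_apply]
  ring

theorem sTensor_add_aTensor (H : IsMetricOn h O) (hW : ContDiffAt ℝ ∞ W y) (hy : y ∈ O) (u v : E) :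
    sTensor h W y u v + aTensor h W y u v = tTensor h W y u v := by
  rw [sTensor_eq H hW hy, aTensor_eq H hW hy]; ring

/-- The one-form `σ w - (s + a)(·, w^♯) / 2`; it is `α` for `w = W`. -/
def alphaOp (h : E → E →L[ℝ] E →L[ℝ] ℝ) (T : E → E →L[ℝ] E →L[ℝ] ℝ) (σ : ℝ)
    (w : E → E →L[ℝ] ℝ) (y u : E) : ℝ :=
  σ * w y u - T y u (sharp h y (w y)) / 2

/-- The tensor `w^l R_{lijk} - w_i a_{jk} + (s + a)_{i[j} w_{k]}`, where `T = s + a`; it is `β`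
for `w = W`. -/
def betaOp (h : E → E →L[ℝ] E →L[ℝ] ℝ) (T : E → E →L[ℝ] E →L[ℝ] ℝ)
    (w : E → E →L[ℝ] ℝ) (y a b c : E) : ℝ :=
  w y (curvature h y b c a) - w y a * ((T y b c - T y c b) / 2)
    + (T y a b * w y c - T y a c * w y b) / 2

theorem alphaTensor_eq (H : IsMetricOn h O) (hW : ContDiffAt ℝ ∞ W y) (hy : y ∈ O) (u : E) :
    alphaTensor h W σ y u = alphaOp h (tTensor h W) σ W y u := by
  rw [alphaTensor, alphaOp, sTensor_add_aTensor H hW hy]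

/-- `T` is invariant under `ξ` on `O`. -/
def IsInvariantOn (T : E → E →L[ℝ] E →L[ℝ] ℝ) (O : Set E) (ξ : E → E) : Prop :=
  ∀ y ∈ O, ∀ u v,
    fderiv ℝ T y (ξ y) u v + T y (fderiv ℝ ξ y u) v + T y u (fderiv ℝ ξ y v) = 0

variable [FiniteDimensional ℝ E]

theorem betaTensor_eq (H : IsMetricOn h O) (hW : ContDiffAt ℝ ∞ W y) (hy : y ∈ O) (a b c : E) :
    betaTensor h W y a b c = betaOp h (tTensor h W) W y a b c := by
  rw [betaTensor, betaOp, sTensor_add_aTensor H hW hy, sTensor_add_aTensor H hW hy,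
    aTensor_eq H hW hy, riemann, H.apply_sharp hy]

theorem contDiffAt_cov (H : IsMetricOn h O) (hW : ContDiffAt ℝ ∞ W y) (hy : y ∈ O) :
    ContDiffAt ℝ ∞ (cov h W) y := by
  have h1 : ContDiffAt ℝ ∞ (fun z => (fderiv ℝ W z).flip) y :=
    ((ContinuousLinearMap.flipₗᵢ ℝ E E ℝ).contDiff.contDiffAt).comp y (contDiffAt_fderiv hW)
  have h2 : ContDiffAt ℝ ∞ (fun z => ContinuousLinearMap.compL ℝ E E ℝ (W z)) y :=
    (ContinuousLinearMap.compL ℝ E E ℝ).contDiff.contDiffAt.comp y hW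
  exact h1.sub (h2.clm_comp (H.contDiffAt_chr hy))

theorem contDiffAt_tTensor (H : IsMetricOn h O) (hW : ContDiffAt ℝ ∞ W y) (hy : y ∈ O) :
    ContDiffAt ℝ ∞ (tTensor h W) y :=
  (contDiffAt_cov H hW hy).sub ((hW.smulRight hW).const_smul (1 / 2 : ℝ))

namespace IsKillingOn

/-- Raising an index commutes with the Lie derivative along a Killing field: differentiate h(w^♯, ·)
= w along `ξ` and use the Killing equation. -/
theorem lie_sharp (H : IsMetricOn h O) (K : IsKillingOn h O ξ) (hw : ContDiffAt ℝ ∞ w y)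
    (hy : y ∈ O) :
    fderiv ℝ (fun z => sharp h z (w z)) y (ξ y) - fderiv ℝ ξ y (sharp h y (w y))
      = sharp h y (lieForm ξ w y) := by
  have dh := differentiableAt_of_smooth (H.smooth y hy)
  have ds := differentiableAt_of_smooth (H.contDiffAt_sharp hy hw)
  refine H.ext_vec hy fun u => ?_
  have h0 : fderiv ℝ (fun z => h z (sharp h z (w z))) y = fderiv ℝ w y := by
    apply Filter.EventuallyEq.fderiv_eq
    filter_upwards [H.isOpen.mem_nhds hy] with z hz using H.apply_sharp hz _
  have h1 := congrArg (fun l => l (ξ y) u) h0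
  rw [fderiv_clm_apply_apply dh ds] at h1
  have h2 := K.lie y hy (sharp h y (w y)) u
  rw [H.apply_sharp hy] at h2
  rw [H.apply_sharp hy, lieForm_apply, ← h1]
  simp only [map_sub, sub_apply, add_apply]
  linear_combination -h2

/-- The operator is linear in `w` with coefficients σ, T and the inverse metric, all annihilated by
the Lie derivative, so the Leibniz rule leaves only the term in which `w` is differentiated. -/
theorem lie_alphaOp (H : IsMetricOn h O) (K : IsKillingOn h O ξ) {T : E → E →L[ℝ] E →L[ℝ] ℝ}
    (hT : ∀ z ∈ O, ContDiffAt ℝ ∞ T z) (iT : IsInvariantOn T O ξ) (hw : ContDiffAt ℝ ∞ w y)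
    (hy : y ∈ O) (u : E) :
    fderiv ℝ (fun z => alphaOp h T σ w z u) y (ξ y) + alphaOp h T σ w y (fderiv ℝ ξ y u)
      = alphaOp h T σ (lieForm ξ w) y u := by
  have dw := differentiableAt_of_smooth hw
  have dT := differentiableAt_of_smooth (hT y hy)
  have ds := differentiableAt_of_smooth (H.contDiffAt_sharp hy hw)
  have dc : ∀ a : E, DifferentiableAt ℝ (fun _ : E => a) y := differentiableAt_const
  have e1 : (fun z => alphaOp h T σ w z u)
      = fun z => σ * w z u - 2⁻¹ * T z u (sharp h z (w z)) := by
    funext z; rw [alphaOp]; ring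
  have d1 : DifferentiableAt ℝ (fun z => w z u) y := dw.clm_apply (dc u)
  have d2 : DifferentiableAt ℝ (fun z => T z u (sharp h z (w z))) y :=
    (dT.clm_apply (dc u)).clm_apply ds
  have e2 := fderiv_clm_apply₂ dT (dc u) ds (ξ y)
  simp only [fderiv_const_apply, zero_apply, map_zero, add_zero] at e2
  rw [e1, fderiv_fun_sub (d1.const_mul σ) (d2.const_mul _), fderiv_const_mul d1,
    fderiv_const_mul d2]
  simp only [sub_apply, smul_apply, smul_eq_mul]
  rw [e2, fderiv_clm_apply_const dw, alphaOp, alphaOp, lieForm_apply, ← K.lie_sharp H hw hy]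
  simp only [map_sub]
  linear_combination -(1 / 2) * iT y hy u (sharp h y (w y))

/-- Same mechanism as `lie_alphaOp`, with `lie_curvature` providing the invariance of the curvature
coefficient. -/
theorem lie_betaOp (H : IsMetricOn h O) (K : IsKillingOn h O ξ) {T : E → E →L[ℝ] E →L[ℝ] ℝ}
    (hT : ∀ z ∈ O, ContDiffAt ℝ ∞ T z) (iT : IsInvariantOn T O ξ) (hw : ContDiffAt ℝ ∞ w y)
    (hy : y ∈ O) (a b c : E) :
    lie₃ ξ (betaOp h T w) y a b c = betaOp h T (lieForm ξ w) y a b c := by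
  have dw := differentiableAt_of_smooth hw
  have dT := differentiableAt_of_smooth (hT y hy)
  have dc : ∀ a : E, DifferentiableAt ℝ (fun _ : E => a) y := differentiableAt_const
  obtain ⟨dR, -⟩ := fderiv_curvature H hy b c a (ξ y)
  have hR := congrArg (w y) (K.lie_curvature H hy b c a)
  simp only [map_add, map_sub, map_zero] at hR
  have dwa : ∀ a : E, HasFDerivAt (fun z => w z a) (fderiv ℝ (fun z => w z a) y) y := fun a =>
    (dw.clm_apply (dc a)).hasFDerivAt
  have dTa : ∀ a b : E, HasFDerivAt (fun z => T z a b) (fderiv ℝ (fun z => T z a b) y) y :=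
    fun a b => ((dT.clm_apply (dc a)).clm_apply (dc b)).hasFDerivAt
  have e1 : ∀ a x : E, fderiv ℝ (fun z => w z a) y x = fderiv ℝ w y x a := fun a x =>
    fderiv_clm_apply_const dw a x
  have e2 : ∀ a b x : E, fderiv ℝ (fun z => T z a b) y x = fderiv ℝ T y x a b := fun a b x =>
    fderiv_clm_apply₂_const dT a b x
  have e3 := fderiv_clm_apply_apply dw dR (ξ y)
  have D := (((dw.clm_apply dR).hasFDerivAt.sub
    ((dwa a).mul (((dTa b c).sub (dTa c b)).mul_const (2⁻¹)))).add
    ((((dTa a b).mul (dwa c)).sub ((dTa a c).mul (dwa b))).mul_const (2⁻¹)))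
  have e4 : (fun z => betaOp h T w z a b c) = fun z =>
      w z (curvature h z b c a) - w z a * ((T z b c - T z c b) * 2⁻¹)
        + (T z a b * w z c - T z a c * w z b) * 2⁻¹ := by
    funext z; rw [betaOp]; ring
  have e5 := HasFDerivAt.fderiv (f := fun z => w z (curvature h z b c a)
    - w z a * ((T z b c - T z c b) * 2⁻¹) + (T z a b * w z c - T z a c * w z b) * 2⁻¹) D
  rw [← e4] at e5
  rw [lie₃, e5]
  simp only [add_apply, sub_apply, smul_apply, smul_eq_mul, Pi.sub_apply, e1, e2, e3, betaOp, lieForm_apply]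
  linear_combination hR - w y a * (iT y hy b c - iT y hy c b) / 2
    + (w y c * iT y hy a b - w y b * iT y hy a c) / 2

end IsKillingOn

end Coord

namespace Coord

variable {E : Type*} [NormedAddCommGroup E] [NormedSpace ℝ E]
  {h : E → E →L[ℝ] E →L[ℝ] ℝ} {O : Set E} {ξ : E → E} {y : E}
  {W w : E → E →L[ℝ] ℝ} {σ : ℝ}

/-! ### Symmetries and iterated Lie derivatives -/

/-- `ξ` is a Killing field on `O` which preserves `s + a`, `α` and `β`; the last two conditions are
expressed through the Lie derivative of `W`. -/
structure IsSymmetryOn (h : E → E →L[ℝ] E →L[ℝ] ℝ) (W : E → E →L[ℝ] ℝ) (σ : ℝ) (O : Set E)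
    (ξ : E → E) : Prop where
  killing : IsKillingOn h O ξ
  invariant : IsInvariantOn (tTensor h W) O ξ
  alpha : ∀ y ∈ O, ∀ u, alphaOp h (tTensor h W) σ (lieForm ξ W) y u = 0
  beta : ∀ y ∈ O, ∀ a b c, betaOp h (tTensor h W) (lieForm ξ W) y a b c = 0

/-- Iterated Lie derivatives of `W` along symmetries, of order at least one. -/
inductive IsIterLie (h : E → E →L[ℝ] E →L[ℝ] ℝ) (W : E → E →L[ℝ] ℝ) (σ : ℝ) (O : Set E) :
    (E → E →L[ℝ] ℝ) → Prop
  | base {ξ : E → E} {v : E → E →L[ℝ] ℝ} (hξ : IsSymmetryOn h W σ O ξ)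
      (hv : ∀ y ∈ O, v y = lieForm ξ W y) : IsIterLie h W σ O v
  | step {w : E → E →L[ℝ] ℝ} {ξ : E → E} {v : E → E →L[ℝ] ℝ} (hw : IsIterLie h W σ O w)
      (hξ : IsSymmetryOn h W σ O ξ) (hv : ∀ y ∈ O, v y = lieForm ξ w y) : IsIterLie h W σ O v

theorem IsSymmetryOn.mono (S : IsSymmetryOn h W σ O ξ) {O' : Set E} (hs : O' ⊆ O) :
    IsSymmetryOn h W σ O' ξ :=
  ⟨S.killing.mono hs, fun y hy => S.invariant y (hs hy), fun y hy => S.alpha y (hs hy),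
    fun y hy => S.beta y (hs hy)⟩

theorem IsIterLie.mono (hw : IsIterLie h W σ O w) {O' : Set E} (hs : O' ⊆ O) :
    IsIterLie h W σ O' w := by
  induction hw with
  | base hξ hv => exact .base (hξ.mono hs) fun y hy => hv y (hs hy)
  | step _ hξ hv ih => exact .step ih (hξ.mono hs) fun y hy => hv y (hs hy)

theorem IsIterLie.smooth (hO : IsOpen O) (hW : ∀ y ∈ O, ContDiffAt ℝ ∞ W y)
    (hw : IsIterLie h W σ O w) : ∀ y ∈ O, ContDiffAt ℝ ∞ w y := by
  induction hw with
  | base hξ hv => exact fun y hy => (contDiffAt_lieForm (hξ.killing.smooth y hy)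
      (hW y hy)).congr_of_eventuallyEq (eventuallyEq_of_eqOn hO hy hv)
  | step _ hξ hv ih => exact fun y hy => (contDiffAt_lieForm (hξ.killing.smooth y hy)
      (ih y hy)).congr_of_eventuallyEq (eventuallyEq_of_eqOn hO hy hv)

theorem isInvariantOn_tTensor (H : IsMetricOn h O) (hW : ∀ y ∈ O, ContDiffAt ℝ ∞ W y)
    (hT : ∀ y ∈ O, ContDiffAt ℝ ∞ (tTensor h W) y)
    (ha : ∀ y ∈ O, ∀ u v, lie₂ ξ (aTensor h W) y u v = 0)
    (hs : ∀ y ∈ O, ∀ u v, lie₂ ξ (sTensor h W) y u v = 0) :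
    IsInvariantOn (tTensor h W) O ξ := by
  intro y hy u v
  have dT := differentiableAt_of_smooth (hT y hy)
  have dc : ∀ a : E, DifferentiableAt ℝ (fun _ : E => a) y := differentiableAt_const
  have d : ∀ u v : E, DifferentiableAt ℝ (fun z => tTensor h W z u v) y := fun u v =>
    (dT.clm_apply (dc u)).clm_apply (dc v)
  have es : (fun z => sTensor h W z u v) =ᶠ[𝓝 y]
      fun z => (2⁻¹ : ℝ) * (tTensor h W z u v + tTensor h W z v u) :=
    eventuallyEq_of_eqOn H.isOpen hy fun z hz => by rw [sTensor_eq H (hW z hz) hz]; ring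
  have ea : (fun z => aTensor h W z u v) =ᶠ[𝓝 y]
      fun z => (2⁻¹ : ℝ) * (tTensor h W z u v - tTensor h W z v u) :=
    eventuallyEq_of_eqOn H.isOpen hy fun z hz => by rw [aTensor_eq H (hW z hz) hz]; ring
  have h1 := ha y hy u v
  have h2 := hs y hy u v
  rw [lie₂, ea.fderiv_eq, fderiv_const_mul ((d u v).fun_sub (d v u)),
    fderiv_fun_sub (d u v) (d v u), aTensor_eq H (hW y hy) hy, aTensor_eq H (hW y hy) hy] at h1
  rw [lie₂, es.fderiv_eq, fderiv_const_mul ((d u v).fun_add (d v u)),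
    fderiv_fun_add (d u v) (d v u), sTensor_eq H (hW y hy) hy, sTensor_eq H (hW y hy) hy] at h2
  simp only [smul_apply, add_apply, sub_apply, smul_eq_mul, fderiv_clm_apply₂_const dT] at h1 h2
  linear_combination h1 + h2

theorem alphaOp_congr {T : E → E →L[ℝ] E →L[ℝ] ℝ} {v : E → E →L[ℝ] ℝ} (hv : v y = w y) (u : E) :
    alphaOp h T σ v y u = alphaOp h T σ w y u := by
  rw [alphaOp, alphaOp, hv]

theorem betaOp_congr {T : E → E →L[ℝ] E →L[ℝ] ℝ} {v : E → E →L[ℝ] ℝ} (hv : v y = w y)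
    (a b c : E) : betaOp h T v y a b c = betaOp h T w y a b c := by
  rw [betaOp, betaOp, hv]

variable [FiniteDimensional ℝ E]

/-- Since α and β are the operators evaluated at W, `lie_alphaOp` and `lie_betaOp` turn their
invariance into the statement that the Lie derivative of W lies in both kernels. -/
theorem isSymmetryOn_of_lie (H : IsMetricOn h O) (hW : ∀ y ∈ O, ContDiffAt ℝ ∞ W y)
    (K : IsKillingOn h O ξ)
    (ha : ∀ y ∈ O, ∀ u v, lie₂ ξ (aTensor h W) y u v = 0)
    (hs : ∀ y ∈ O, ∀ u v, lie₂ ξ (sTensor h W) y u v = 0)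
    (hα : ∀ y ∈ O, ∀ u, lie₁ ξ (alphaTensor h W σ) y u = 0)
    (hβ : ∀ y ∈ O, ∀ u v w, lie₃ ξ (betaTensor h W) y u v w = 0) :
    IsSymmetryOn h W σ O ξ := by
  have hT : ∀ y ∈ O, ContDiffAt ℝ ∞ (tTensor h W) y := fun y hy => contDiffAt_tTensor H (hW y hy) hy
  have iT := isInvariantOn_tTensor H hW hT ha hs
  refine ⟨K, iT, fun y hy u => ?_, fun y hy a b c => ?_⟩
  · rw [← K.lie_alphaOp H hT iT (hW y hy) hy, ← hα y hy u, lie₁, alphaTensor_eq H (hW y hy) hy]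
    congr 2
    exact (eventuallyEq_of_eqOn H.isOpen hy fun z hz => alphaTensor_eq H (hW z hz) hz u).symm.fderiv_eq
  · rw [← K.lie_betaOp H hT iT (hW y hy) hy, ← hβ y hy a b c, lie₃, lie₃,
      betaTensor_eq H (hW y hy) hy, betaTensor_eq H (hW y hy) hy, betaTensor_eq H (hW y hy) hy]
    congr 4
    exact (eventuallyEq_of_eqOn H.isOpen hy fun z hz =>
      betaTensor_eq H (hW z hz) hz a b c).symm.fderiv_eq

/-- By `lie_alphaOp` the forms killed on the whole open set `O` are stable under Lie derivatives
along symmetries, and the first Lie derivatives of W are among them. -/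
theorem IsIterLie.alphaOp_eq_zero (H : IsMetricOn h O) (hW : ∀ y ∈ O, ContDiffAt ℝ ∞ W y)
    (hw : IsIterLie h W σ O w) :
    ∀ y ∈ O, ∀ u, alphaOp h (tTensor h W) σ w y u = 0 := by
  have hT : ∀ y ∈ O, ContDiffAt ℝ ∞ (tTensor h W) y := fun y hy => contDiffAt_tTensor H (hW y hy) hy
  induction hw with
  | base hξ hv => exact fun y hy u => by rw [alphaOp_congr (hv y hy)]; exact hξ.alpha y hy u
  | step hw hξ hv ih =>
    intro y hy u
    rw [alphaOp_congr (hv y hy), ← hξ.killing.lie_alphaOp H hT hξ.invariant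
      (hw.smooth H.isOpen hW y hy) hy, ih y hy,
      fderiv_eq_zero_of_eqOn H.isOpen hy fun z hz => ih z hz u]
    simp

theorem IsIterLie.betaOp_eq_zero (H : IsMetricOn h O) (hW : ∀ y ∈ O, ContDiffAt ℝ ∞ W y)
    (hw : IsIterLie h W σ O w) :
    ∀ y ∈ O, ∀ a b c, betaOp h (tTensor h W) w y a b c = 0 := by
  have hT : ∀ y ∈ O, ContDiffAt ℝ ∞ (tTensor h W) y := fun y hy => contDiffAt_tTensor H (hW y hy) hy
  induction hw with
  | base hξ hv => exact fun y hy a b c => by rw [betaOp_congr (hv y hy)]; exact hξ.beta y hy a b c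
  | step hw hξ hv ih =>
    intro y hy a b c
    rw [betaOp_congr (hv y hy), ← hξ.killing.lie_betaOp H hT hξ.invariant
      (hw.smooth H.isOpen hW y hy) hy, lie₃, ih y hy, ih y hy, ih y hy,
      fderiv_eq_zero_of_eqOn H.isOpen hy fun z hz => ih z hz a b c]
    simp

/-- The values at `y` of the iterated Lie derivatives defined near `y`. -/
def iterValues (h : E → E →L[ℝ] E →L[ℝ] ℝ) (W : E → E →L[ℝ] ℝ) (σ : ℝ) (Ω : Set E) (y : E) :
    Set (E →L[ℝ] ℝ) :=
  {θ | ∃ O : Set E, IsOpen O ∧ y ∈ O ∧ O ⊆ Ω ∧ ∃ w, IsIterLie h W σ O w ∧ w y = θ}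

/-! ### Pointwise consequences of the spanning hypothesis -/

variable {Ω : Set E}

/-- At a fixed point the vanishing of `alphaOp` is a linear condition on the covector, so it passes
to the span and holds for all covectors. The covector h(v, ·) turns the raised index into `v`. -/
theorem tTensor_eq_of_span (H : IsMetricOn h Ω) (hW : ∀ y ∈ Ω, ContDiffAt ℝ ∞ W y) (hy : y ∈ Ω)
    (hspan : Submodule.span ℝ (iterValues h W σ Ω y) = ⊤) (u v : E) :
    tTensor h W y u v = 2 * σ * h y u v := by
  have key : ∀ θ : E →L[ℝ] ℝ, σ * θ u - tTensor h W y u (sharp h y θ) / 2 = 0 := by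
    intro θ
    have hθ : θ ∈ Submodule.span ℝ (iterValues h W σ Ω y) := hspan ▸ Submodule.mem_top
    induction hθ using Submodule.span_induction with
    | mem θ hθ =>
      obtain ⟨O, hO, hyO, hOΩ, w, hw, rfl⟩ := hθ
      exact hw.alphaOp_eq_zero (H.mono hO hOΩ) (fun z hz => hW z (hOΩ hz)) y hyO u
    | zero => simp [sharp]
    | add θ₁ θ₂ _ _ h₁ h₂ =>
      simp only [sharp, map_add, add_apply] at h₁ h₂ ⊢
      linear_combination h₁ + h₂
    | smul c θ _ hc =>
      simp only [sharp, map_smul, smul_apply, smul_eq_mul] at hc ⊢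
      linear_combination c * hc
  have := key (h y v)
  rw [H.sharp_apply hy, H.symm y hy v u] at this
  linear_combination -2 * this

/-- The same linearity argument for `betaOp`, tested on h(a, ·). With T = 2σh the antisymmetric part
drops out and only the curvature and the two metric terms remain. -/
theorem curvature_of_span (H : IsMetricOn h Ω) (hW : ∀ y ∈ Ω, ContDiffAt ℝ ∞ W y) (hy : y ∈ Ω)
    (hspan : Submodule.span ℝ (iterValues h W σ Ω y) = ⊤) (a b c d : E) :
    riemann h y a b c d = σ * (h y a c * h y b d - h y a d * h y b c) := by
  have key : ∀ θ : E →L[ℝ] ℝ,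
      θ (curvature h y c d b) - θ b * ((tTensor h W y c d - tTensor h W y d c) / 2)
        + (tTensor h W y b c * θ d - tTensor h W y b d * θ c) / 2 = 0 := by
    intro θ
    have hθ : θ ∈ Submodule.span ℝ (iterValues h W σ Ω y) := hspan ▸ Submodule.mem_top
    induction hθ using Submodule.span_induction with
    | mem θ hθ =>
      obtain ⟨O, hO, hyO, hOΩ, w, hw, rfl⟩ := hθ
      exact hw.betaOp_eq_zero (H.mono hO hOΩ) (fun z hz => hW z (hOΩ hz)) y hyO b c d
    | zero => simp
    | add θ₁ θ₂ _ _ h₁ h₂ =>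
      simp only [add_apply] at h₁ h₂ ⊢
      linear_combination h₁ + h₂
    | smul c θ _ hc =>
      simp only [smul_apply, smul_eq_mul] at hc ⊢
      linear_combination c * hc
  have := key (h y a)
  simp only [tTensor_eq_of_span H hW hy hspan] at this
  rw [riemann]
  rw [H.symm y hy d c] at this
  linear_combination this

end Coord

namespace Coord

variable {E : Type*} [NormedAddCommGroup E] [NormedSpace ℝ E]
  {h : E → E →L[ℝ] E →L[ℝ] ℝ} {O : Set E} {ξ : E → E} {y : E}
  {W w : E → E →L[ℝ] ℝ} {σ : ℝ} {ψ φ ψ₁ ψ₂ : E → ℝ}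

/-! ### Functions whose Hessian is `-σ ψ h` -/

/-- `ψ` is a smooth solution of `ψ_{;ij} = -σ ψ h_{ij}` on `O`. -/
structure IsSol (h : E → E →L[ℝ] E →L[ℝ] ℝ) (σ : ℝ) (O : Set E) (ψ : E → ℝ) : Prop where
  smooth : ∀ y ∈ O, ContDiffAt ℝ ∞ ψ y
  hess : ∀ y ∈ O, ∀ u v,
    fderiv ℝ (fderiv ℝ ψ) y u v = fderiv ℝ ψ y (chr h y u v) - σ * ψ y * h y u v

/-- The derivative of a function along a vector field. -/
def dir (ξ : E → E) (ψ : E → ℝ) (z : E) : ℝ := fderiv ℝ ψ z (ξ z)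

theorem contDiffAt_dir (hξ : ContDiffAt ℝ ∞ ξ y) (hψ : ContDiffAt ℝ ∞ ψ y) :
    ContDiffAt ℝ ∞ (dir ξ ψ) y :=
  (contDiffAt_fderiv hψ).clm_apply hξ

/-- The Lie derivative commutes with the differential of a function. -/
theorem fderiv_dir (hξ : ContDiffAt ℝ ∞ ξ y) (hψ : ContDiffAt ℝ ∞ ψ y) :
    fderiv ℝ (dir ξ ψ) y = lieForm ξ (fderiv ℝ ψ) y := by
  ext u
  rw [lieForm_apply, fderiv_fderiv_comm hψ]
  exact fderiv_clm_apply_apply (differentiableAt_of_smooth (contDiffAt_fderiv hψ))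
    (differentiableAt_of_smooth hξ) u

namespace IsSol

theorem mono (hψ : IsSol h σ O ψ) {O' : Set E} (hs : O' ⊆ O) : IsSol h σ O' ψ :=
  ⟨fun y hy => hψ.smooth y (hs hy), fun y hy => hψ.hess y (hs hy)⟩

theorem fderiv_add_smul (h₁ : IsSol h σ O ψ₁) (h₂ : IsSol h σ O ψ₂) (a b : ℝ) (hy : y ∈ O) :
    fderiv ℝ (fun z => a * ψ₁ z + b * ψ₂ z) y = a • fderiv ℝ ψ₁ y + b • fderiv ℝ ψ₂ y := by
  have d₁ := differentiableAt_of_smooth (h₁.smooth y hy)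
  have d₂ := differentiableAt_of_smooth (h₂.smooth y hy)
  rw [fderiv_fun_add (d₁.const_mul a) (d₂.const_mul b), fderiv_const_mul d₁, fderiv_const_mul d₂]

theorem add_smul (hO : IsOpen O) (h₁ : IsSol h σ O ψ₁) (h₂ : IsSol h σ O ψ₂) (a b : ℝ) :
    IsSol h σ O fun z => a * ψ₁ z + b * ψ₂ z := by
  refine ⟨fun y hy => (contDiffAt_const.mul (h₁.smooth y hy)).add
    (contDiffAt_const.mul (h₂.smooth y hy)), fun y hy u v => ?_⟩
  have d₁ := differentiableAt_of_smooth (contDiffAt_fderiv (h₁.smooth y hy))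
  have d₂ := differentiableAt_of_smooth (contDiffAt_fderiv (h₂.smooth y hy))
  have e : fderiv ℝ (fun z => a * ψ₁ z + b * ψ₂ z) =ᶠ[𝓝 y]
      fun z => a • fderiv ℝ ψ₁ z + b • fderiv ℝ ψ₂ z :=
    eventuallyEq_of_eqOn hO hy fun z hz => fderiv_add_smul h₁ h₂ a b hz
  rw [e.fderiv_eq, fderiv_add_smul h₁ h₂ a b hy, fderiv_fun_add (d₁.fun_const_smul a)
    (d₂.fun_const_smul b), fderiv_fun_const_smul d₁, fderiv_fun_const_smul d₂]
  simp only [add_apply, smul_apply, smul_eq_mul, h₁.hess y hy, h₂.hess y hy]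
  ring

/-- The equation involves only h and its connection, which `ξ` preserves: `lie_chr` absorbs the
terms with derivatives of Γ and `ξ`, the Killing equation those with derivatives of h. -/
theorem dir [FiniteDimensional ℝ E] (H : IsMetricOn h O) (K : IsKillingOn h O ξ)
    (hψ : IsSol h σ O ψ) : IsSol h σ O (dir ξ ψ) := by
  refine ⟨fun y hy => contDiffAt_dir (K.smooth y hy) (hψ.smooth y hy), fun y hy u v => ?_⟩
  have hξ := K.smooth y hy
  have sψ := hψ.smooth y hy
  have dξ := differentiableAt_of_smooth hξ
  have ddξ := differentiableAt_of_smooth (contDiffAt_fderiv hξ)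
  have dψ := differentiableAt_of_smooth sψ
  have ddψ := differentiableAt_of_smooth (contDiffAt_fderiv sψ)
  have dddψ := differentiableAt_of_smooth (contDiffAt_fderiv (contDiffAt_fderiv sψ))
  have dΓ := differentiableAt_of_smooth (H.contDiffAt_chr hy)
  have dh := differentiableAt_of_smooth (H.smooth y hy)
  have dc : ∀ a : E, DifferentiableAt ℝ (fun _ : E => a) y := differentiableAt_const
  -- the second derivative of the directional derivative
  have e1 : fderiv ℝ (Coord.dir ξ ψ) =ᶠ[𝓝 y] lieForm ξ (fderiv ℝ ψ) :=
    eventuallyEq_of_eqOn H.isOpen hy fun z hz => fderiv_dir (K.smooth z hz) (hψ.smooth z hz)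
  have e2 : fderiv ℝ (fderiv ℝ (Coord.dir ξ ψ)) y u v
      = fderiv ℝ (fderiv ℝ (fderiv ℝ ψ)) y u (ξ y) v
        + fderiv ℝ (fderiv ℝ ψ) y (fderiv ℝ ξ y u) v
        + (fderiv ℝ (fderiv ℝ ψ) y u (fderiv ℝ ξ y v)
          + fderiv ℝ ψ y (fderiv ℝ (fderiv ℝ ξ) y u v)) := by
    have d1 := dddψ.clm_apply dξ
    have d2 : DifferentiableAt ℝ (fun z => (fderiv ℝ ψ z).comp (fderiv ℝ ξ z)) y :=
      ddψ.clm_comp ddξ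
    rw [e1.fderiv_eq, show lieForm ξ (fderiv ℝ ψ) = fun z => fderiv ℝ (fderiv ℝ ψ) z (ξ z)
      + (fderiv ℝ ψ z).comp (fderiv ℝ ξ z) from rfl, fderiv_fun_add d1 d2]
    rw [add_apply, fderiv_clm_apply_apply dddψ dξ, add_apply, add_apply,
      ← fderiv_clm_apply_const d2]
    congr 1
    rw [show (fun z => ((fderiv ℝ ψ z).comp (fderiv ℝ ξ z)) v)
      = fun z => fderiv ℝ ψ z (fderiv ℝ ξ z v) from rfl,
      fderiv_clm_apply_apply ddψ (ddξ.clm_apply (dc v)), fderiv_clm_apply_const ddξ]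
  -- the derivative of the equation along the field
  have e3 : fderiv ℝ (fderiv ℝ (fderiv ℝ ψ)) y (ξ y) u v
      = fderiv ℝ (fderiv ℝ ψ) y (ξ y) (chr h y u v)
        + fderiv ℝ ψ y (fderiv ℝ (chr h) y (ξ y) u v)
        - σ * (fderiv ℝ ψ y (ξ y) * h y u v + ψ y * fderiv ℝ h y (ξ y) u v) := by
    have e : (fun z => fderiv ℝ (fderiv ℝ ψ) z u v) =ᶠ[𝓝 y]
        fun z => fderiv ℝ ψ z (chr h z u v) - σ * (ψ z * h z u v) :=
      eventuallyEq_of_eqOn H.isOpen hy fun z hz => by rw [hψ.hess z hz]; ring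
    have dΓuv := (dΓ.clm_apply (dc u)).clm_apply (dc v)
    have dhuv : DifferentiableAt ℝ (fun z => h z u v) y := (dh.clm_apply (dc u)).clm_apply (dc v)
    rw [← fderiv_clm_apply₂_const dddψ, e.fderiv_eq, fderiv_fun_sub (ddψ.clm_apply dΓuv)
      ((dψ.fun_mul dhuv).const_mul σ), fderiv_const_mul (dψ.fun_mul dhuv), fderiv_fun_mul dψ dhuv]
    simp only [sub_apply, smul_apply, add_apply, smul_eq_mul]
    rw [fderiv_clm_apply_apply ddψ dΓuv, fderiv_clm_apply₂_const dΓ, fderiv_clm_apply₂_const dh]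
    ring
  have l := congrArg (fderiv ℝ ψ y) (K.lie_chr H hy u v)
  simp only [map_add, map_sub, map_zero] at l
  rw [e2, fderiv_fderiv_comm (contDiffAt_fderiv sψ) u, e3, hψ.hess y hy (fderiv ℝ ξ y u) v,
    hψ.hess y hy u (fderiv ℝ ξ y v), fderiv_dir hξ sψ, lieForm_apply, Coord.dir]
  linear_combination l - σ * ψ y * K.lie y hy u v

end IsSol

/-! ### The one-forms `ψ₁ dψ₂ - ψ₂ dψ₁` -/

/-- The one-form `ψ₁ dψ₂ - ψ₂ dψ₁`. -/
def pair (ψ₁ ψ₂ : E → ℝ) (y : E) : E →L[ℝ] ℝ := ψ₁ y • fderiv ℝ ψ₂ y - ψ₂ y • fderiv ℝ ψ₁ y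

theorem contDiffAt_pair (h₁ : ContDiffAt ℝ ∞ ψ₁ y) (h₂ : ContDiffAt ℝ ∞ ψ₂ y) :
    ContDiffAt ℝ ∞ (pair ψ₁ ψ₂) y :=
  (h₁.smul (contDiffAt_fderiv h₂)).sub (h₂.smul (contDiffAt_fderiv h₁))

theorem lieForm_add {v : E → E →L[ℝ] ℝ} (hv : ContDiffAt ℝ ∞ v y) (hw : ContDiffAt ℝ ∞ w y) :
    lieForm ξ (fun z => v z + w z) y = lieForm ξ v y + lieForm ξ w y := by
  rw [lieForm, fderiv_fun_add (differentiableAt_of_smooth hv) (differentiableAt_of_smooth hw)]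
  ext u
  simp [lieForm]
  ring

theorem lieForm_sub {v : E → E →L[ℝ] ℝ} (hv : ContDiffAt ℝ ∞ v y) (hw : ContDiffAt ℝ ∞ w y) :
    lieForm ξ (fun z => v z - w z) y = lieForm ξ v y - lieForm ξ w y := by
  rw [lieForm, fderiv_fun_sub (differentiableAt_of_smooth hv) (differentiableAt_of_smooth hw)]
  ext u
  simp [lieForm]
  ring

theorem lieForm_smul (hψ : ContDiffAt ℝ ∞ ψ y) (hw : ContDiffAt ℝ ∞ w y) :
    lieForm ξ (fun z => ψ z • w z) y = dir ξ ψ y • w y + ψ y • lieForm ξ w y := by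
  rw [lieForm, fderiv_fun_smul (differentiableAt_of_smooth hψ) (differentiableAt_of_smooth hw)]
  ext u
  simp [lieForm, dir]
  ring

theorem lieForm_pair (hξ : ContDiffAt ℝ ∞ ξ y) (h₁ : ContDiffAt ℝ ∞ ψ₁ y)
    (h₂ : ContDiffAt ℝ ∞ ψ₂ y) :
    lieForm ξ (pair ψ₁ ψ₂) y = pair (dir ξ ψ₁) ψ₂ y + pair ψ₁ (dir ξ ψ₂) y := by
  have g₁ := contDiffAt_fderiv h₁
  have g₂ := contDiffAt_fderiv h₂
  rw [show pair ψ₁ ψ₂ = fun z => ψ₁ z • fderiv ℝ ψ₂ z - ψ₂ z • fderiv ℝ ψ₁ z from rfl,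
    lieForm_sub (h₁.fun_smul g₂) (h₂.fun_smul g₁), lieForm_smul h₁ g₂, lieForm_smul h₂ g₁, pair, pair,
    fderiv_dir hξ h₁, fderiv_dir hξ h₂]
  abel

/-- One-forms which are combinations, with functions as coefficients, of forms
`ψ₁ dψ₂ - ψ₂ dψ₁` for solutions `ψ₁`, `ψ₂`. -/
inductive IsPairForm (h : E → E →L[ℝ] E →L[ℝ] ℝ) (σ : ℝ) (O : Set E) : (E → E →L[ℝ] ℝ) → Prop
  | of {f ψ₁ ψ₂ : E → ℝ} (hf : ∀ y ∈ O, ContDiffAt ℝ ∞ f y) (h₁ : IsSol h σ O ψ₁)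
      (h₂ : IsSol h σ O ψ₂) : IsPairForm h σ O fun y => f y • pair ψ₁ ψ₂ y
  | add {v w : E → E →L[ℝ] ℝ} (hv : IsPairForm h σ O v) (hw : IsPairForm h σ O w) :
      IsPairForm h σ O fun y => v y + w y
  | congr {v w : E → E →L[ℝ] ℝ} (hv : IsPairForm h σ O v) (hw : ∀ y ∈ O, w y = v y) :
      IsPairForm h σ O w

namespace IsPairForm

theorem smooth (hO : IsOpen O) (hw : IsPairForm h σ O w) : ∀ y ∈ O, ContDiffAt ℝ ∞ w y := by
  induction hw with
  | of hf h₁ h₂ =>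
    exact fun y hy => (hf y hy).fun_smul (contDiffAt_pair (h₁.smooth y hy) (h₂.smooth y hy))
  | add _ _ ih₁ ih₂ => exact fun y hy => (ih₁ y hy).add (ih₂ y hy)
  | congr _ hw ih =>
    exact fun y hy => (ih y hy).congr_of_eventuallyEq (eventuallyEq_of_eqOn hO hy hw)

/-- By the Leibniz rule the derivative falls on the coefficient or on one of the solutions, and
`IsSol.dir` keeps the latter a solution. -/
theorem lieForm [FiniteDimensional ℝ E] (H : IsMetricOn h O) (K : IsKillingOn h O ξ)
    (hw : IsPairForm h σ O w) : IsPairForm h σ O (lieForm ξ w) := by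
  induction hw with
  | @of f ψ₁ ψ₂ hf h₁ h₂ =>
    have hf' : ∀ y ∈ O, ContDiffAt ℝ ∞ (Coord.dir ξ f) y := fun y hy =>
      contDiffAt_dir (K.smooth y hy) (hf y hy)
    refine ((of hf' h₁ h₂).add ((of hf (h₁.dir H K) h₂).add (of hf h₁ (h₂.dir H K)))).congr
      fun y hy => ?_
    rw [lieForm_smul (hf y hy) (contDiffAt_pair (h₁.smooth y hy) (h₂.smooth y hy)),
      lieForm_pair (K.smooth y hy) (h₁.smooth y hy) (h₂.smooth y hy), smul_add]
  | @add v w hv hw ih₁ ih₂ =>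
    exact (ih₁.add ih₂).congr fun y hy => lieForm_add (hv.smooth H.isOpen y hy)
      (hw.smooth H.isOpen y hy)
  | congr hv hw ih =>
    exact ih.congr fun y hy => lieForm_congr (eventuallyEq_of_eqOn H.isOpen hy hw)

end IsPairForm

/-- The one-jets at `p` of the solutions defined near `p`. -/
def jets (h : E → E →L[ℝ] E →L[ℝ] ℝ) (σ : ℝ) (p : E) : Submodule ℝ (ℝ × (E →L[ℝ] ℝ)) where
  carrier := {j | ∃ O : Set E, IsOpen O ∧ p ∈ O ∧ ∃ ψ, IsSol h σ O ψ ∧ (ψ p, fderiv ℝ ψ p) = j}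
  zero_mem' := ⟨univ, isOpen_univ, mem_univ p, fun _ => 0,
    ⟨fun _ _ => contDiffAt_const, fun y _ u v => by simp⟩, by simp⟩
  add_mem' := by
    rintro _ _ ⟨O₁, hO₁, hp₁, ψ₁, h₁, rfl⟩ ⟨O₂, hO₂, hp₂, ψ₂, h₂, rfl⟩
    have g₁ := h₁.mono (inter_subset_left (t := O₂))
    have g₂ := h₂.mono (inter_subset_right (s := O₁))
    refine ⟨O₁ ∩ O₂, hO₁.inter hO₂, ⟨hp₁, hp₂⟩, _, g₁.add_smul (hO₁.inter hO₂) g₂ 1 1, ?_⟩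
    rw [g₁.fderiv_add_smul g₂ 1 1 ⟨hp₁, hp₂⟩]
    simp
  smul_mem' := by
    rintro c _ ⟨O₁, hO₁, hp₁, ψ₁, h₁, rfl⟩
    refine ⟨O₁, hO₁, hp₁, _, h₁.add_smul hO₁ h₁ c 0, ?_⟩
    rw [h₁.fderiv_add_smul h₁ c 0 hp₁]
    simp

theorem IsPairForm.mem_jets (hO : IsOpen O) (hy : y ∈ O) (hw : IsPairForm h σ O w) :
    ((0 : ℝ), w y) ∈ jets h σ y := by
  induction hw with
  | @of f ψ₁ ψ₂ hf h₁ h₂ =>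
    have : ((0 : ℝ), pair ψ₁ ψ₂ y) ∈ jets h σ y := by
      -- Freezing the coefficients of ψ₁dψ₂ - ψ₂dψ₁ at `y` gives a solution with constant
      -- coefficients that vanishes at `y` and has the value of the form as its differential there.
      refine ⟨O, hO, hy, _, h₁.add_smul hO h₂ (-ψ₂ y) (ψ₁ y), ?_⟩
      rw [h₁.fderiv_add_smul h₂ _ _ hy, pair]
      refine Prod.ext (by simp; ring) ?_
      simp only [neg_smul]
      abel
    have := (jets h σ y).smul_mem (f y) this
    simpa using this
  | add _ _ ih₁ ih₂ => simpa using (jets h σ y).add_mem ih₁ ih₂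
  | congr _ hw ih => rw [hw y hy]; exact ih

end Coord

namespace Coord

variable {E : Type*} [NormedAddCommGroup E] [NormedSpace ℝ E]
  {h : E → E →L[ℝ] E →L[ℝ] ℝ} {Ω O : Set E} {ξ : E → E} {p y : E}
  {W w : E → E →L[ℝ] ℝ} {σ : ℝ} {ψ φ ψ₁ ψ₂ : E → ℝ}

/-! ### The potential of `W` and the jets of solutions -/

theorem contDiffAt_of_hasFDerivAt (hO : IsOpen O) {f : E → ℝ} {w : E → E →L[ℝ] ℝ}
    (hf : ∀ y ∈ O, HasFDerivAt f (w y) y) (hw : ∀ y ∈ O, ContDiffAt ℝ ∞ w y) (hy : y ∈ O) :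
    ContDiffAt ℝ ∞ f y := by
  have : ContDiffOn ℝ ∞ f O := by
    rw [contDiffOn_infty_iff_fderiv_of_isOpen hO]
    exact ⟨fun z hz => (hf z hz).differentiableAt.differentiableWithinAt,
      ContDiffOn.congr (fun z hz => (hw z hz).contDiffWithinAt) fun z hz => (hf z hz).fderiv⟩
  exact this.contDiffAt (hO.mem_nhds hy)

/-- As W = -2 d(log φ), its Lie derivative is -2 d(ξφ/φ), and the quotient rule produces the pair
form with factor -2/φ². -/
theorem lieForm_potential (hO : IsOpen O) (hξ : ∀ y ∈ O, ContDiffAt ℝ ∞ ξ y)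
    (hφ : ∀ y ∈ O, ContDiffAt ℝ ∞ φ y) (hφ0 : ∀ y, φ y ≠ 0)
    (hWφ : ∀ y ∈ O, W y = (-2 / φ y) • fderiv ℝ φ y) (hy : y ∈ O) :
    lieForm ξ W y = (-2 / φ y ^ 2) • pair φ (dir ξ φ) y := by
  have sφ := hφ y hy
  have si : ContDiffAt ℝ ∞ (fun z => -2 / φ z) y := contDiffAt_const.div sφ (hφ0 y)
  rw [lieForm_congr (eventuallyEq_of_eqOn hO hy hWφ), lieForm_smul si (contDiffAt_fderiv sφ),
    pair, fderiv_dir (hξ y hy) sφ]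
  have d : dir ξ (fun z => -2 / φ z) y = 2 / φ y ^ 2 * dir ξ φ y := by
    have := ((hasDerivAt_inv (hφ0 y)).comp_hasFDerivAt y
      (differentiableAt_of_smooth sφ).hasFDerivAt).const_mul (-2)
    simp only [Function.comp_apply, ← div_eq_mul_inv] at this
    rw [dir, this.fderiv, dir]
    simp
    ring
  rw [d, smul_sub, smul_smul, smul_smul,
    show -2 / φ y ^ 2 * φ y = -2 / φ y by have := hφ0 y; field_simp,
    show 2 / φ y ^ 2 * dir ξ φ y = -(-2 / φ y ^ 2 * dir ξ φ y) by ring, neg_smul]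
  abel

theorem fderiv_pair (h₁ : ContDiffAt ℝ ∞ ψ₁ y) (h₂ : ContDiffAt ℝ ∞ ψ₂ y) (u v : E) :
    fderiv ℝ (pair ψ₁ ψ₂) y u v
      = fderiv ℝ ψ₁ y u * fderiv ℝ ψ₂ y v - fderiv ℝ ψ₂ y u * fderiv ℝ ψ₁ y v
        + ψ₁ y * fderiv ℝ (fderiv ℝ ψ₂) y u v - ψ₂ y * fderiv ℝ (fderiv ℝ ψ₁) y u v := by
  have d₁ := differentiableAt_of_smooth h₁
  have d₂ := differentiableAt_of_smooth h₂
  have g₁ := differentiableAt_of_smooth (contDiffAt_fderiv h₁)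
  have g₂ := differentiableAt_of_smooth (contDiffAt_fderiv h₂)
  rw [show pair ψ₁ ψ₂ = fun z => ψ₁ z • fderiv ℝ ψ₂ z - ψ₂ z • fderiv ℝ ψ₁ z from rfl,
    fderiv_fun_sub (d₁.fun_smul g₂) (d₂.fun_smul g₁), fderiv_fun_smul d₁ g₂, fderiv_fun_smul d₂ g₁]
  simp only [sub_apply, add_apply, smul_apply, ContinuousLinearMap.smulRight_apply, smul_eq_mul]
  ring

variable [FiniteDimensional ℝ E]

/-- Where `s = 2σh` and `a = 0`, the form `W` is `-2 d(log φ)` for a positive solution `φ`. -/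
theorem exists_potential (H : IsMetricOn h O) (hc : Convex ℝ O)
    (hW : ∀ y ∈ O, ContDiffAt ℝ ∞ W y)
    (hT : ∀ y ∈ O, ∀ u v, tTensor h W y u v = 2 * σ * h y u v) :
    ∃ φ : E → ℝ, IsSol h σ O φ ∧ (∀ y, φ y ≠ 0) ∧
      ∀ y ∈ O, W y = (-2 / φ y) • fderiv ℝ φ y := by
  -- The antisymmetric part of T is half the exterior derivative of W up to sign, so symmetry of h
  -- makes W closed, and the Poincaré lemma applies on the convex set.
  have hsymm : ∀ y ∈ O, ∀ u v, fderiv ℝ W y u v = fderiv ℝ W y v u := by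
    intro y hy u v
    have h1 := hT y hy u v
    have h2 := hT y hy v u
    rw [tTensor_apply] at h1 h2
    rw [H.symm y hy, H.chr_symm hy] at h2
    linear_combination h2 - h1
  obtain ⟨F, hF⟩ := hc.exists_forall_hasFDerivAt_of_fderiv_symmetric H.isOpen
    (fun y hy => (differentiableAt_of_smooth (hW y hy)).differentiableWithinAt) hsymm
  -- The exponent -1/2 makes dφ = -φW/2, so that the Hessian of φ is -φ/2 times W_{i;j} - W_iW_j/2,
  -- which is T; then T = 2σh gives -σφh.
  set φ : E → ℝ := fun y => Real.exp (-(1 / 2) * F y) with hφ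
  have hφ0 : ∀ y, φ y ≠ 0 := fun y => (Real.exp_pos _).ne'
  have hφs : ∀ y ∈ O, ContDiffAt ℝ ∞ φ y := fun y hy =>
    (contDiffAt_const.mul (contDiffAt_of_hasFDerivAt H.isOpen hF hW hy)).exp
  have hφd : ∀ y ∈ O, fderiv ℝ φ y = (-(1 / 2) * φ y) • W y := fun y hy => by
    rw [((hF y hy).const_mul (-(1 / 2))).exp.fderiv, smul_smul, mul_comm]
  refine ⟨φ, ⟨hφs, fun y hy u v => ?_⟩, hφ0, fun y hy => ?_⟩
  · have e : fderiv ℝ φ =ᶠ[𝓝 y] fun z => (-(1 / 2) * φ z) • W z :=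
      eventuallyEq_of_eqOn H.isOpen hy hφd
    have dφ := differentiableAt_of_smooth (hφs y hy)
    have h1 := hT y hy v u
    rw [tTensor_apply, H.chr_symm hy] at h1
    rw [e.fderiv_eq, fderiv_fun_smul (dφ.const_mul _) (differentiableAt_of_smooth (hW y hy)),
      fderiv_const_mul dφ, hφd y hy, H.symm y hy u v]
    simp only [add_apply, smul_apply, ContinuousLinearMap.smulRight_apply, smul_eq_mul]
    linear_combination -(1 / 2) * φ y * h1
  · rw [hφd y hy, smul_smul]
    have := hφ0 y
    rw [show -2 / φ y * (-(1 / 2) * φ y) = 1 by field_simp, one_smul]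

theorem IsIterLie.isPairForm (H : IsMetricOn h O) (hφ : IsSol h σ O φ) (hφ0 : ∀ y, φ y ≠ 0)
    (hWφ : ∀ y ∈ O, W y = (-2 / φ y) • fderiv ℝ φ y) (hw : IsIterLie h W σ O w) :
    IsPairForm h σ O w := by
  induction hw with
  | base hξ hv =>
    refine (IsPairForm.of (f := fun y => -2 / φ y ^ 2) (fun y hy => ?_) hφ
      (hφ.dir H hξ.killing)).congr fun y hy => ?_
    · exact contDiffAt_const.div ((hφ.smooth y hy).pow 2) (pow_ne_zero 2 (hφ0 y))
    · rw [hv y hy, lieForm_potential H.isOpen hξ.killing.smooth hφ.smooth hφ0 hWφ hy]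
  | step _ hξ hv ih => exact (ih.lieForm H hξ.killing).congr hv

/-- The iterated Lie derivatives are pair forms and so contribute all jets with value zero.
Subtracting a multiple of the jet of φ, whose value is nonzero, reduces any jet to one of these. -/
theorem jets_eq_top (H : IsMetricOn h O) (hp : p ∈ O) (hφ : IsSol h σ O φ) (hφ0 : ∀ y, φ y ≠ 0)
    (hWφ : ∀ y ∈ O, W y = (-2 / φ y) • fderiv ℝ φ y)
    (hspan : Submodule.span ℝ (iterValues h W σ Ω p) = ⊤) : jets h σ p = ⊤ := by
  have key : ∀ θ : E →L[ℝ] ℝ, ((0 : ℝ), θ) ∈ jets h σ p := by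
    intro θ
    have hθ : θ ∈ Submodule.span ℝ (iterValues h W σ Ω p) := hspan ▸ Submodule.mem_top
    induction hθ using Submodule.span_induction with
    | mem θ hθ =>
      obtain ⟨O', hO', hpO', -, w, hw, rfl⟩ := hθ
      have hs : O ∩ O' ⊆ O := inter_subset_left
      have hI := H.isOpen.inter hO'
      exact ((hw.mono inter_subset_right).isPairForm (H.mono hI hs) (hφ.mono hs) hφ0
        fun y hy => hWφ y (hs hy)).mem_jets hI ⟨hp, hpO'⟩
    | zero => exact (jets h σ p).zero_mem
    | add θ₁ θ₂ _ _ h₁ h₂ => simpa using (jets h σ p).add_mem h₁ h₂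
    | smul c θ _ hc => simpa using (jets h σ p).smul_mem c hc
  refine eq_top_iff.2 fun j _ => ?_
  have h1 : (φ p, fderiv ℝ φ p) ∈ jets h σ p := ⟨O, H.isOpen, hp, φ, hφ, rfl⟩
  have h2 := (jets h σ p).add_mem ((jets h σ p).smul_mem (j.1 / φ p) h1)
    (key (j.2 - (j.1 / φ p) • fderiv ℝ φ p))
  convert h2
  ext1
  · simp [hφ0 p]
  · simp

/-- Solutions realizing different jets may live on different neighbourhoods. The jet space is
finite-dimensional, so a basis of jets has a common ball, and linear combinations realize all others
on it. -/
theorem exists_sol_of_jets_eq_top (hΩ : IsOpen Ω) (hp : p ∈ Ω) (hj : jets h σ p = ⊤) :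
    ∃ r > 0, Metric.ball p r ⊆ Ω ∧ ∀ (c : ℝ) (θ : E →L[ℝ] ℝ),
      ∃ ψ, IsSol h σ (Metric.ball p r) ψ ∧ ψ p = c ∧ fderiv ℝ ψ p = θ := by
  have : FiniteDimensional ℝ (ℝ × (E →L[ℝ] ℝ)) := inferInstance
  let b := Module.finBasis ℝ (ℝ × (E →L[ℝ] ℝ))
  have hb : ∀ i, b i ∈ jets h σ p := fun i => hj ▸ Submodule.mem_top
  choose U hU hpU f hf hfb using hb
  have hI : IsOpen (Ω ∩ ⋂ i, U i) := hΩ.inter (isOpen_iInter_of_finite hU)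
  obtain ⟨r, hr, hrs⟩ := Metric.isOpen_iff.1 hI p ⟨hp, mem_iInter.2 hpU⟩
  refine ⟨r, hr, fun z hz => (hrs hz).1, ?_⟩
  let J : Submodule ℝ (ℝ × (E →L[ℝ] ℝ)) :=
    { carrier := {j | ∃ ψ, IsSol h σ (Metric.ball p r) ψ ∧ (ψ p, fderiv ℝ ψ p) = j}
      zero_mem' := ⟨fun _ => 0, ⟨fun _ _ => contDiffAt_const, fun y _ u v => by simp⟩, by simp⟩
      add_mem' := by
        rintro _ _ ⟨ψ₁, h₁, rfl⟩ ⟨ψ₂, h₂, rfl⟩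
        refine ⟨_, h₁.add_smul Metric.isOpen_ball h₂ 1 1, ?_⟩
        rw [h₁.fderiv_add_smul h₂ 1 1 (Metric.mem_ball_self hr)]
        simp
      smul_mem' := by
        rintro c _ ⟨ψ₁, h₁, rfl⟩
        refine ⟨_, h₁.add_smul Metric.isOpen_ball h₁ c 0, ?_⟩
        rw [h₁.fderiv_add_smul h₁ c 0 (Metric.mem_ball_self hr)]
        simp }
  have hJ : J = ⊤ := by
    rw [eq_top_iff, ← b.span_eq, Submodule.span_le]
    rintro _ ⟨i, rfl⟩
    exact ⟨f i, (hf i).mono fun z hz => mem_iInter.1 (hrs hz).2 i, hfb i⟩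
  intro c θ
  obtain ⟨ψ, hψ, hj⟩ : (c, θ) ∈ J := hJ ▸ Submodule.mem_top
  exact ⟨ψ, hψ, congrArg Prod.fst hj, congrArg Prod.snd hj⟩

/-- If the iterated Lie derivatives of `W` span the cotangent spaces, all jets are realized by
solutions on a ball. -/
theorem exists_sol (H : IsMetricOn h Ω) (hW : ∀ y ∈ Ω, ContDiffAt ℝ ∞ W y)
    (hspan : ∀ y ∈ Ω, Submodule.span ℝ (iterValues h W σ Ω y) = ⊤) (hp : p ∈ Ω) :
    ∃ r > 0, Metric.ball p r ⊆ Ω ∧ ∀ (c : ℝ) (θ : E →L[ℝ] ℝ),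
      ∃ ψ, IsSol h σ (Metric.ball p r) ψ ∧ ψ p = c ∧ fderiv ℝ ψ p = θ := by
  obtain ⟨r, hr, hrs⟩ := Metric.isOpen_iff.1 H.isOpen p hp
  have HB := H.mono Metric.isOpen_ball hrs
  obtain ⟨φ, hφ, hφ0, hWφ⟩ := exists_potential (σ := σ) HB (convex_ball p r)
    (fun y hy => hW y (hrs hy)) fun y hy => tTensor_eq_of_span H hW (hrs hy) (hspan y (hrs hy))
  exact exists_sol_of_jets_eq_top H.isOpen hp
    (jets_eq_top HB (Metric.mem_ball_self hr) hφ hφ0 hWφ (hspan p hp))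

/-! ### Killing fields from pairs of solutions -/

/-- The vector field `ψ₁ ∇ψ₂ - ψ₂ ∇ψ₁`. -/
def pairField (h : E → E →L[ℝ] E →L[ℝ] ℝ) (ψ₁ ψ₂ : E → ℝ) (y : E) : E :=
  sharp h y (pair ψ₁ ψ₂ y)

/-- In the covariant derivative of ψ₁dψ₂ - ψ₂dψ₁ the products of first derivatives are
antisymmetric, and the Hessian terms cancel because both equal -σψ₁ψ₂h. -/
theorem isKillingOn_pairField (H : IsMetricOn h O) (h₁ : IsSol h σ O ψ₁) (h₂ : IsSol h σ O ψ₂) :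
    IsKillingOn h O (pairField h ψ₁ ψ₂) := by
  have hs : ∀ y ∈ O, ContDiffAt ℝ ∞ (pairField h ψ₁ ψ₂) y := fun y hy =>
    H.contDiffAt_sharp hy (contDiffAt_pair (h₁.smooth y hy) (h₂.smooth y hy))
  refine ⟨hs, fun y hy u v => ?_⟩
  have dh := differentiableAt_of_smooth (H.smooth y hy)
  have dK := differentiableAt_of_smooth (hs y hy)
  have h0 : fderiv ℝ (fun z => h z (pairField h ψ₁ ψ₂ z)) y = fderiv ℝ (pair ψ₁ ψ₂) y :=
    (eventuallyEq_of_eqOn H.isOpen hy fun z hz => H.apply_sharp hz _).fderiv_eq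
  have h1 : ∀ a b : E, fderiv ℝ h y a (pairField h ψ₁ ψ₂ y) b
      + h y (fderiv ℝ (pairField h ψ₁ ψ₂) y a) b = fderiv ℝ (pair ψ₁ ψ₂) y a b := fun a b => by
    rw [← h0, fderiv_clm_apply_apply dh dK, add_apply]
  have k1 := h1 u v
  have k2 := h1 v u
  rw [fderiv_pair (h₁.smooth y hy) (h₂.smooth y hy), h₁.hess y hy, h₂.hess y hy] at k1 k2
  have g := H.apply_chr hy u v (pairField h ψ₁ ψ₂ y)
  rw [H.symm y hy, pairField, H.apply_sharp hy, ← pairField, pair] at g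
  simp only [sub_apply, smul_apply, smul_eq_mul] at g
  rw [H.chr_symm hy v u, H.symm y hy v u] at k2
  rw [H.symm y hy u]
  rw [H.fderiv_symm hy u v, H.fderiv_symm hy v u] at g
  linear_combination k1 + k2 + 2 * g

end Coord

namespace Coord

variable {E : Type*} [NormedAddCommGroup E] [NormedSpace ℝ E]
  {h : E → E →L[ℝ] E →L[ℝ] ℝ} {Ω O : Set E} {ξ η : E → E} {p y : E}
  {σ : ℝ} {ψ φ ψ₁ ψ₂ : E → ℝ}

/-! ### Rigidity of Killing fields -/

theorem IsKillingOn.congr (hO : IsOpen O) (K : IsKillingOn h O ξ) (hη : ∀ y ∈ O, η y = ξ y) :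
    IsKillingOn h O η := by
  refine ⟨fun y hy => (K.smooth y hy).congr_of_eventuallyEq (eventuallyEq_of_eqOn hO hy hη),
    fun y hy u v => ?_⟩
  rw [(eventuallyEq_of_eqOn hO hy hη).fderiv_eq, hη y hy]
  exact K.lie y hy u v

theorem IsKillingOn.add (K : IsKillingOn h O ξ) (L : IsKillingOn h O η) :
    IsKillingOn h O (ξ + η) := by
  refine ⟨fun y hy => (K.smooth y hy).add (L.smooth y hy), fun y hy u v => ?_⟩
  rw [fderiv_add (differentiableAt_of_smooth (K.smooth y hy))
    (differentiableAt_of_smooth (L.smooth y hy))]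
  simp only [Pi.add_apply, map_add, add_apply]
  linear_combination K.lie y hy u v + L.lie y hy u v

theorem IsKillingOn.smul (c : ℝ) (K : IsKillingOn h O ξ) : IsKillingOn h O (c • ξ) := by
  refine ⟨fun y hy => (K.smooth y hy).const_smul c, fun y hy u v => ?_⟩
  rw [fderiv_const_smul (differentiableAt_of_smooth (K.smooth y hy))]
  simp only [Pi.smul_apply, map_smul, smul_apply, smul_eq_mul]
  linear_combination c * K.lie y hy u v

theorem isKillingOn_zero : IsKillingOn h O 0 :=
  ⟨fun y _ => contDiffAt_const, fun y _ u v => by simp⟩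

variable (h O) in
/-- The Killing fields on `O`, extended by zero. -/
def killingSpace : Submodule ℝ (E → E) where
  carrier := {ξ | IsKillingOn h O ξ ∧ ∀ y, y ∉ O → ξ y = 0}
  zero_mem' := ⟨isKillingOn_zero, fun _ _ => rfl⟩
  add_mem' := fun {ξ η} hξ hη => ⟨hξ.1.add hη.1, fun y hy => by simp [hξ.2 y hy, hη.2 y hy]⟩
  smul_mem' := fun c ξ hξ => ⟨hξ.1.smul c, fun y hy => by simp [hξ.2 y hy]⟩

/-- The exterior derivative of the one-form dual to `ξ`. -/
def dFlat (h : E → E →L[ℝ] E →L[ℝ] ℝ) (ξ : E → E) (p u v : E) : ℝ :=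
  fderiv ℝ (fun z => h z (ξ z)) p u v - fderiv ℝ (fun z => h z (ξ z)) p v u

theorem dFlat_eq (H : IsMetricOn h O) (hp : p ∈ O) (hξ : ContDiffAt ℝ ∞ ξ p) (u v : E) :
    dFlat h ξ p u v = fderiv ℝ h p u (ξ p) v - fderiv ℝ h p v (ξ p) u
      + h p (fderiv ℝ ξ p u) v - h p (fderiv ℝ ξ p v) u := by
  have dh := differentiableAt_of_smooth (H.smooth p hp)
  have dξ := differentiableAt_of_smooth hξ
  rw [dFlat, fderiv_clm_apply_apply dh dξ, fderiv_clm_apply_apply dh dξ]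
  simp only [add_apply]
  ring

variable [FiniteDimensional ℝ E]

/-- Along the segment from `p` to `q`, which convexity keeps in `O`, `lie_chr` makes the pair (ξ,
Dξ) satisfy a linear differential equation with bounded coefficients. It starts at zero, so
Grönwall's inequality keeps it zero. -/
theorem IsKillingOn.eq_zero_of_jet (H : IsMetricOn h O) (hc : Convex ℝ O)
    (K : IsKillingOn h O ξ) (hp : p ∈ O) (h0 : ξ p = 0) (h1 : fderiv ℝ ξ p = 0) :
    ∀ q ∈ O, ξ q = 0 := by
  intro q hq
  set d := q - p with hd
  set γ : ℝ → E := fun t => p + t • d with hγ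
  have hγd : ∀ t, HasDerivAt γ d t := fun t => by
    have := ((hasDerivAt_id t).smul_const d).const_add p
    rwa [one_smul] at this
  have hγO : ∀ t ∈ Icc (0 : ℝ) 1, γ t ∈ O := fun t ht =>
    hc.add_smul_sub_mem hp hq ht
  have hγc : Continuous γ := by fun_prop
  have hcont : ∀ {F : Type _} [NormedAddCommGroup F] [NormedSpace ℝ F] (f : E → F),
      (∀ y ∈ O, ContDiffAt ℝ ∞ f y) → ∃ C, ∀ t ∈ Icc (0 : ℝ) 1, ‖f (γ t)‖ ≤ C := by
    intro F _ _ f hf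
    exact isCompact_Icc.exists_bound_of_continuousOn fun t ht =>
      ((hf _ (hγO t ht)).continuousAt.comp hγc.continuousAt).continuousWithinAt
  obtain ⟨C₁, hC₁⟩ := hcont (chr h) fun y hy => H.contDiffAt_chr hy
  obtain ⟨C₂, hC₂⟩ := hcont (fderiv ℝ (chr h)) fun y hy => contDiffAt_fderiv (H.contDiffAt_chr hy)
  have hC₁0 : 0 ≤ C₁ := (norm_nonneg _).trans (hC₁ 0 (by simp))
  have hC₂0 : 0 ≤ C₂ := (norm_nonneg _).trans (hC₂ 0 (by simp))
  set z : ℝ → E × (E →L[ℝ] E) := fun t => (ξ (γ t), fderiv ℝ ξ (γ t)) with hz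
  set z' : ℝ → E × (E →L[ℝ] E) := fun t =>
    (fderiv ℝ ξ (γ t) d, fderiv ℝ (fderiv ℝ ξ) (γ t) d) with hz'
  have hder : ∀ t ∈ Icc (0 : ℝ) 1, HasDerivAt z (z' t) t := fun t ht => by
    have s := K.smooth _ (hγO t ht)
    exact ((differentiableAt_of_smooth s).hasFDerivAt.comp_hasDerivAt t (hγd t)).prodMk
      ((differentiableAt_of_smooth (contDiffAt_fderiv s)).hasFDerivAt.comp_hasDerivAt t (hγd t))
  -- The 1 bounds the derivative of ξ, C₂ the term with DΓ, and 3C₁ the three terms of `lie_chr`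
  -- pairing Γ with Dξ; ‖d‖ is the speed of the segment.
  have hbound : ∀ t ∈ Icc (0 : ℝ) 1, ‖z' t‖ ≤ ((1 + 3 * C₁ + C₂) * ‖d‖) * ‖z t‖ := by
    intro t ht
    have b1 : ‖ξ (γ t)‖ ≤ ‖z t‖ := norm_fst_le (z t)
    have b2 : ‖fderiv ℝ ξ (γ t)‖ ≤ ‖z t‖ := norm_snd_le (z t)
    have c1 := hC₁ t ht
    have c2 := hC₂ t ht
    have hdz : 0 ≤ ‖d‖ * ‖z t‖ := by positivity
    refine norm_prod_le_iff.2 ⟨?_, ContinuousLinearMap.opNorm_le_bound _ (by positivity) ?_⟩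
    · calc ‖fderiv ℝ ξ (γ t) d‖ ≤ ‖fderiv ℝ ξ (γ t)‖ * ‖d‖ := ContinuousLinearMap.le_opNorm _ _
        _ ≤ ‖z t‖ * ‖d‖ := by gcongr
        _ ≤ (1 + 3 * C₁ + C₂) * ‖d‖ * ‖z t‖ := by nlinarith [mul_nonneg hC₁0 hdz, mul_nonneg hC₂0 hdz]
    · intro v
      have l := K.lie_chr H (hγO t ht) d v
      have e : fderiv ℝ (fderiv ℝ ξ) (γ t) d v = -(fderiv ℝ (chr h) (γ t) (ξ (γ t)) d v)
          - chr h (γ t) (fderiv ℝ ξ (γ t) d) v - chr h (γ t) d (fderiv ℝ ξ (γ t) v)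
          + fderiv ℝ ξ (γ t) (chr h (γ t) d v) := by
        linear_combination (norm := module) l
      have n1 : ‖fderiv ℝ (chr h) (γ t) (ξ (γ t)) d v‖ ≤ C₂ * ‖z t‖ * ‖d‖ * ‖v‖ := by
        refine (ContinuousLinearMap.le_opNorm₂ _ _ _).trans ?_
        gcongr
        refine (ContinuousLinearMap.le_opNorm _ _).trans ?_
        gcongr
      have n0 : ∀ v, ‖fderiv ℝ ξ (γ t) v‖ ≤ ‖z t‖ * ‖v‖ := fun v =>
        (ContinuousLinearMap.le_opNorm _ _).trans (by gcongr)
      have nΓ : ∀ u v, ‖chr h (γ t) u v‖ ≤ C₁ * ‖u‖ * ‖v‖ := fun u v =>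
        (ContinuousLinearMap.le_opNorm₂ _ _ _).trans (by gcongr)
      have n2 : ‖chr h (γ t) (fderiv ℝ ξ (γ t) d) v‖ ≤ C₁ * (‖z t‖ * ‖d‖) * ‖v‖ :=
        (nΓ _ _).trans (by gcongr; exact n0 d)
      have n3 : ‖chr h (γ t) d (fderiv ℝ ξ (γ t) v)‖ ≤ C₁ * ‖d‖ * (‖z t‖ * ‖v‖) :=
        (nΓ _ _).trans (by gcongr; exact n0 v)
      have n4 : ‖fderiv ℝ ξ (γ t) (chr h (γ t) d v)‖ ≤ ‖z t‖ * (C₁ * ‖d‖ * ‖v‖) :=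
        (n0 _).trans (by gcongr; exact nΓ d v)
      have hpos : 0 ≤ ‖d‖ * ‖z t‖ * ‖v‖ := by positivity
      calc ‖fderiv ℝ (fderiv ℝ ξ) (γ t) d v‖
          ≤ C₂ * ‖z t‖ * ‖d‖ * ‖v‖ + C₁ * (‖z t‖ * ‖d‖) * ‖v‖ + C₁ * ‖d‖ * (‖z t‖ * ‖v‖)
            + ‖z t‖ * (C₁ * ‖d‖ * ‖v‖) := by
            rw [e]
            refine (norm_add_le _ _).trans (add_le_add ((norm_sub_le _ _).trans (add_le_add
              ((norm_sub_le _ _).trans (add_le_add ?_ n2)) n3)) n4)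
            rwa [norm_neg]
        _ ≤ (1 + 3 * C₁ + C₂) * ‖d‖ * ‖z t‖ * ‖v‖ := by linarith
  have hfin := eq_zero_of_abs_deriv_le_mul_abs_self_of_eq_zero_right (f := z) (f' := z')
    (a := 0) (b := 1) (fun t ht => (hder t ht).continuousAt.continuousWithinAt)
    (fun t ht => (hder t (Ico_subset_Icc_self ht)).hasDerivWithinAt) (by simp [hz, hγ, h0, h1])
    (fun t ht => hbound t (Ico_subset_Icc_self ht)) 1 (by simp)
  have := congrArg Prod.fst hfin
  simpa [hz, hγ, hd] using this

/-- At a zero of `ξ` the Killing equation says that Dξ is skew with respect to h. Then `dFlat` is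
twice this skew form, so its vanishing forces Dξ = 0. -/
theorem IsKillingOn.eq_zero_of_dFlat (H : IsMetricOn h O) (hc : Convex ℝ O)
    (K : IsKillingOn h O ξ) (hp : p ∈ O) (h0 : ξ p = 0) (h1 : ∀ u v, dFlat h ξ p u v = 0) :
    ∀ q ∈ O, ξ q = 0 := by
  refine K.eq_zero_of_jet H hc hp h0 ?_
  ext1 u
  refine H.ext_vec hp fun v => ?_
  have k1 := h1 u v
  have k2 := K.lie p hp u v
  rw [dFlat_eq H hp (K.smooth p hp)] at k1
  rw [h0, H.symm p hp u] at k2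
  simp only [h0, map_zero, zero_apply] at k1 k2 ⊢
  linarith

theorem dFlat_pairField (H : IsMetricOn h O) (hp : p ∈ O) (h₁ : IsSol h σ O ψ₁)
    (h₂ : IsSol h σ O ψ₂) (hξ : ∀ y ∈ O, ξ y = pairField h ψ₁ ψ₂ y) (u v : E) :
    dFlat h ξ p u v = 2 * (fderiv ℝ ψ₁ p u * fderiv ℝ ψ₂ p v - fderiv ℝ ψ₂ p u * fderiv ℝ ψ₁ p v) := by
  have h0 : fderiv ℝ (fun z => h z (ξ z)) p = fderiv ℝ (pair ψ₁ ψ₂) p :=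
    (eventuallyEq_of_eqOn H.isOpen hp fun z hz => by
      rw [hξ z hz, pairField, H.apply_sharp hz]).fderiv_eq
  have s₁ := h₁.smooth p hp
  have s₂ := h₂.smooth p hp
  rw [dFlat, h0, fderiv_pair s₁ s₂, fderiv_pair s₁ s₂, fderiv_fderiv_comm s₁ v u,
    fderiv_fderiv_comm s₂ v u]
  ring

/-! ### Counting Killing fields by their one-jets -/

variable {n : ℕ} (b : Basis (Fin n) ℝ E)

/-- The jet of a Killing field at `p`: the components of the dual one-form and of its exterior
derivative. -/
def killingJet (H : IsMetricOn h O) (hp : p ∈ O) :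
    killingSpace h O →ₗ[ℝ] (Fin n → ℝ) × ((Σ j : Fin n, Fin j) → ℝ) where
  toFun ξ := (fun i => h p (ξ.1 p) (b i), fun s => dFlat h ξ.1 p (b (s.2.castLE s.1.2.le)) (b s.1))
  map_add' ξ η := by
    refine Prod.ext (funext fun i => by simp) (funext fun s => ?_)
    have sξ := ξ.2.1.smooth p hp
    have sη := η.2.1.smooth p hp
    change dFlat h (ξ.1 + η.1) p _ _ = dFlat h ξ.1 p _ _ + dFlat h η.1 p _ _
    rw [dFlat_eq (ξ := ξ.1 + η.1) H hp (sξ.add sη), dFlat_eq H hp sξ, dFlat_eq H hp sη,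
      fderiv_add (differentiableAt_of_smooth sξ) (differentiableAt_of_smooth sη)]
    simp only [Pi.add_apply, map_add, add_apply]
    ring
  map_smul' c ξ := by
    refine Prod.ext (funext fun i => by simp) (funext fun s => ?_)
    have sξ := ξ.2.1.smooth p hp
    change dFlat h (c • ξ.1) p _ _ = c * dFlat h ξ.1 p _ _
    rw [dFlat_eq (ξ := c • ξ.1) H hp (sξ.const_smul c), dFlat_eq H hp sξ,
      fderiv_const_smul (differentiableAt_of_smooth sξ)]
    simp only [Pi.smul_apply, map_smul, smul_apply, smul_eq_mul]
    ring

/-- The index type consists of the pairs i < j, which suffice to determine an alternating form;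
rigidity does the rest. -/
theorem killingJet_injective (H : IsMetricOn h O) (hc : Convex ℝ O) (hp : p ∈ O) :
    Function.Injective (killingJet b H hp) := by
  rw [injective_iff_map_eq_zero]
  intro ξ hξ
  have h1 : ∀ i, h p (ξ.1 p) (b i) = 0 := fun i => congrFun (congrArg Prod.fst hξ) i
  have h2 : ∀ s : (Σ j : Fin n, Fin j), dFlat h ξ.1 p (b (s.2.castLE s.1.2.le)) (b s.1) = 0 :=
    fun s => congrFun (congrArg Prod.snd hξ) s
  have h0 : ξ.1 p = 0 := by
    refine H.ext_vec hp fun w => ?_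
    have : ((h p (ξ.1 p) : E →L[ℝ] ℝ) : E →ₗ[ℝ] ℝ) = 0 := b.ext fun i => h1 i
    simpa using congrArg (fun l : E →ₗ[ℝ] ℝ => l w) this
  set A : E →L[ℝ] E →L[ℝ] ℝ := fderiv ℝ (fun z => h z (ξ.1 z)) p with hA
  have hlt : ∀ i j : Fin n, i < j → A (b i) (b j) = A (b j) (b i) := fun i j hij =>
    sub_eq_zero.1 (h2 ⟨j, ⟨i, hij⟩⟩)
  have hAsymm : ∀ u v, A u v = A v u := by
    have : (A : E →L[ℝ] E →L[ℝ] ℝ).toLinearMap₁₂ = A.flip.toLinearMap₁₂ := by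
      refine b.ext fun i => b.ext fun j => ?_
      change A (b i) (b j) = A (b j) (b i)
      rcases lt_trichotomy i j with hij | rfl | hij
      · exact hlt i j hij
      · rfl
      · exact (hlt j i hij).symm
    exact fun u v => congrArg (fun l : E →ₗ[ℝ] E →ₗ[ℝ] ℝ => l u v) this
  have hz := ξ.2.1.eq_zero_of_dFlat H hc hp h0 fun u v => sub_eq_zero.2 (hAsymm u v)
  ext y
  by_cases hy : y ∈ O
  · exact hz y hy
  · exact ξ.2.2 y hy

open scoped Classical in
theorem exists_killing_of_sol (H : IsMetricOn h O) (h₁ : IsSol h σ O ψ₁) (h₂ : IsSol h σ O ψ₂) :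
    ∃ ξ : killingSpace h O, ∀ y ∈ O, ξ.1 y = pairField h ψ₁ ψ₂ y :=
  ⟨⟨fun y => if y ∈ O then pairField h ψ₁ ψ₂ y else 0,
    (isKillingOn_pairField H h₁ h₂).congr H.isOpen fun _ hy => if_pos hy,
    fun _ hy => if_neg hy⟩, fun _ hy => if_pos hy⟩

/-- Take a solution φ with jet (1, 0) at `p` and solutions fᵢ with jets (0, bⁱ), bⁱ being the dual
basis. Pairing φ with fᵢ gives the i-th covector with zero exterior derivative, and pairing fᵢ with
fⱼ gives a field vanishing at `p` whose exterior derivative is 2 bⁱ ∧ bʲ. -/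
theorem killingJet_surjective (H : IsMetricOn h O) (hp : p ∈ O)
    (hsol : ∀ (c : ℝ) (θ : E →L[ℝ] ℝ), ∃ ψ, IsSol h σ O ψ ∧ ψ p = c ∧ fderiv ℝ ψ p = θ) :
    Function.Surjective (killingJet b H hp) := by
  classical
  obtain ⟨φ, hφ, hφ0, hφ1⟩ := hsol 1 0
  choose f hf hf0 hf1 using fun i => hsol 0 (b.coord i).toContinuousLinearMap
  choose k hk using fun i => exists_killing_of_sol H hφ (hf i)
  choose m hm using fun s : (Σ j : Fin n, Fin j) =>
    exists_killing_of_sol H (hf (s.2.castLE s.1.2.le)) (hf s.1)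
  have hkj : ∀ i, killingJet b H hp (k i) = (Pi.single i 1, 0) := by
    intro i
    refine Prod.ext (funext fun j => ?_) (funext fun s => ?_)
    · change h p ((k i).1 p) (b j) = _
      rw [hk i p hp, pairField, H.apply_sharp hp, pair, hφ0, hf0, hf1]
      simp [Pi.single_apply, Finsupp.single_apply, eq_comm]
    · change dFlat h (k i).1 p _ _ = 0
      rw [dFlat_pairField H hp hφ (hf i) (hk i), hφ1]
      simp
  have hmj : ∀ s, killingJet b H hp (m s) = (0, Pi.single s 2) := by
    intro s
    refine Prod.ext (funext fun j => ?_) (funext fun t => ?_)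
    · change h p ((m s).1 p) (b j) = 0
      rw [hm s p hp, pairField, H.apply_sharp hp, pair, hf0, hf0]
      simp
    · change dFlat h (m s).1 p _ _ = (Pi.single s 2 : (Σ j : Fin n, Fin j) → ℝ) t
      rw [dFlat_pairField H hp (hf _) (hf _) (hm s), hf1, hf1]
      obtain ⟨l, i⟩ := s
      obtain ⟨l', i'⟩ := t
      have hi := i.2
      have hi' := i'.2
      -- The subtracted product in `dFlat_pairField` would need l = i' and i = l', which contradicts
      -- i < l and i' < l'.
      by_cases hl : l = l'
      · subst hl
        by_cases hii : i = i'
        · subst hii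
          simp [Finsupp.single_apply, Fin.ext_iff]
          omega
        · have : (i' : ℕ) ≠ i := fun hc => hii (Fin.ext hc.symm)
          have hne : (⟨l, i'⟩ : Σ j : Fin n, Fin j) ≠ ⟨l, i⟩ := by
            rintro ⟨⟩; exact hii rfl
          rw [Pi.single_eq_of_ne hne]
          simp [Finsupp.single_apply, Fin.ext_iff, this]
          omega
      · have hne : (⟨l', i'⟩ : Σ j : Fin n, Fin j) ≠ ⟨l, i⟩ := by
          intro hc; exact hl (congrArg Sigma.fst hc).symm
        rw [Pi.single_eq_of_ne hne]
        have : (l' : ℕ) ≠ l := fun hc => hl (Fin.ext hc.symm)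
        simp [Finsupp.single_apply, Fin.ext_iff, this]
        omega
  rintro ⟨a, c⟩
  -- The division by 2 compensates the factor 2 in `dFlat_pairField`.
  refine ⟨∑ i, a i • k i + ∑ s, (c s / 2) • m s, ?_⟩
  simp only [map_add, map_sum, map_smul, hkj, hmj]
  refine Prod.ext (funext fun j => ?_) (funext fun s => ?_)
  · simp [Prod.fst_sum, Finset.sum_apply, Pi.single_apply]
  · simp [Prod.snd_sum, Finset.sum_apply, Pi.single_apply]

theorem finrank_killingSpace (b : Basis (Fin n) ℝ E) (H : IsMetricOn h O) (hc : Convex ℝ O)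
    (hp : p ∈ O)
    (hsol : ∀ (c : ℝ) (θ : E →L[ℝ] ℝ), ∃ ψ, IsSol h σ O ψ ∧ ψ p = c ∧ fderiv ℝ ψ p = θ) :
    finrank ℝ (killingSpace h O) = n * (n + 1) / 2 := by
  rw [(LinearEquiv.ofBijective _ ⟨killingJet_injective b H hc hp,
    killingJet_surjective b H hp hsol⟩).finrank_eq, finrank_prod, finrank_pi, finrank_pi,
    Fintype.card_fin, Fintype.card_sigma]
  simp only [Fintype.card_fin]
  -- The n covector components are absorbed as the last term of 0 + 1 + ... + n.
  rw [Fin.sum_univ_eq_sum_range (fun i => i) n, add_comm, ← Finset.sum_range_succ (fun i => i) n,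
    Finset.sum_range_id, Nat.add_sub_cancel, mul_comm]

end Coord

namespace Coord

variable {E : Type*} [NormedAddCommGroup E] [NormedSpace ℝ E]

/-! ### Behaviour of the Killing equation under changes of coordinates -/

/-- Naturality of the Lie derivative. Second derivatives of τ arise both from differentiating the
pulled back metric and from the relation between the fields, and they cancel by symmetry. -/
theorem lie_metric_of_pullback {h h' : E → E →L[ℝ] E →L[ℝ] ℝ} {ξ ξ' τ : E → E} {y : E}
    (hτ : ContDiffAt ℝ ∞ τ y) (hh : ContDiffAt ℝ ∞ h (τ y)) (hξ : ContDiffAt ℝ ∞ ξ (τ y))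
    (hh' : ContDiffAt ℝ ∞ h' y) (hξ' : ContDiffAt ℝ ∞ ξ' y)
    (eh : ∀ᶠ z in 𝓝 y, ∀ u v, h' z u v = h (τ z) (fderiv ℝ τ z u) (fderiv ℝ τ z v))
    (eξ : ∀ᶠ z in 𝓝 y, fderiv ℝ τ z (ξ' z) = ξ (τ z)) (u v : E) :
    fderiv ℝ h' y (ξ' y) u v + h' y (fderiv ℝ ξ' y u) v + h' y u (fderiv ℝ ξ' y v)
      = fderiv ℝ h (τ y) (ξ (τ y)) (fderiv ℝ τ y u) (fderiv ℝ τ y v)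
        + h (τ y) (fderiv ℝ ξ (τ y) (fderiv ℝ τ y u)) (fderiv ℝ τ y v)
        + h (τ y) (fderiv ℝ τ y u) (fderiv ℝ ξ (τ y) (fderiv ℝ τ y v)) := by
  have dτ := differentiableAt_of_smooth hτ
  have ddτ := differentiableAt_of_smooth (contDiffAt_fderiv hτ)
  have dh := differentiableAt_of_smooth hh
  have dξ := differentiableAt_of_smooth hξ
  have dξ' := differentiableAt_of_smooth hξ'
  have dc : ∀ a : E, DifferentiableAt ℝ (fun _ : E => a) y := differentiableAt_const
  have e1 : ∀ w, fderiv ℝ (fderiv ℝ τ) y w (ξ' y) + fderiv ℝ τ y (fderiv ℝ ξ' y w)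
      = fderiv ℝ ξ (τ y) (fderiv ℝ τ y w) := fun w => by
    rw [← fderiv_clm_apply_apply ddτ dξ', Filter.EventuallyEq.fderiv_eq eξ]
    exact congrArg (fun l : E →L[ℝ] E => l w) (fderiv_comp y dξ dτ)
  have e2 : fderiv ℝ h' y (ξ' y) u v
      = fderiv ℝ h (τ y) (fderiv ℝ τ y (ξ' y)) (fderiv ℝ τ y u) (fderiv ℝ τ y v)
        + h (τ y) (fderiv ℝ (fderiv ℝ τ) y (ξ' y) u) (fderiv ℝ τ y v)
        + h (τ y) (fderiv ℝ τ y u) (fderiv ℝ (fderiv ℝ τ) y (ξ' y) v) := by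
    have e : (fun z => h' z u v) =ᶠ[𝓝 y] fun z => h (τ z) (fderiv ℝ τ z u) (fderiv ℝ τ z v) :=
      eh.mono fun z hz => hz u v
    have dhτ : DifferentiableAt ℝ (fun z => h (τ z)) y := dh.comp y dτ
    rw [← fderiv_clm_apply₂_const (differentiableAt_of_smooth hh'), e.fderiv_eq,
      fderiv_clm_apply₂ dhτ (ddτ.clm_apply (dc u)) (ddτ.clm_apply (dc v)),
      fderiv_clm_apply_const ddτ, fderiv_clm_apply_const ddτ,
      show fderiv ℝ (fun z => h (τ z)) y = (fderiv ℝ h (τ y)).comp (fderiv ℝ τ y) from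
        fderiv_comp y dh dτ]
    rfl
  have eh0 := eh.self_of_nhds
  rw [e2, eh0, eh0, ← eξ.self_of_nhds, ← e1 u, ← e1 v, fderiv_fderiv_comm hτ u,
    fderiv_fderiv_comm hτ v]
  simp only [map_add, add_apply]
  ring

end Coord

/-! ### Coordinate expressions in smooth charts -/

section Manifold

variable {n : ℕ} {M : Type*} [TopologicalSpace M] [ChartedSpace (EuclideanSpace ℝ (Fin n)) M]
  {e e' : ChartOf n M} {y : EuclideanSpace ℝ (Fin n)}

theorem mdifferentiable_of_mem_maximalAtlas
    (he : e ∈ IsManifold.maximalAtlas (𝓡 n) ∞ M) : e.MDifferentiable (𝓡 n) (𝓡 n) :=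
  ⟨(contMDiffOn_of_mem_maximalAtlas he).mdifferentiableOn (by simp),
    (contMDiffOn_symm_of_mem_maximalAtlas he).mdifferentiableOn (by simp)⟩

/-- The derivative of the inverse of a smooth chart. -/
def symmDeriv (he : e ∈ IsManifold.maximalAtlas (𝓡 n) ∞ M) (hy : y ∈ e.target) :
    EuclideanSpace ℝ (Fin n) ≃L[ℝ] TangentSpace (𝓡 n) (e.symm y) :=
  (mdifferentiable_of_mem_maximalAtlas he).symm.mfderiv hy

theorem coe_symmDeriv (he : e ∈ IsManifold.maximalAtlas (𝓡 n) ∞ M) (hy : y ∈ e.target) :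
    (symmDeriv he hy : EuclideanSpace ℝ (Fin n) →L[ℝ] TangentSpace (𝓡 n) (e.symm y))
      = mfderiv (𝓡 n) (𝓡 n) e.symm y := rfl

theorem symmDeriv_fieldIn (he : e ∈ IsManifold.maximalAtlas (𝓡 n) ∞ M) (hy : y ∈ e.target)
    (ξ : VField n M) : symmDeriv he hy (fieldIn e ξ y) = ξ (e.symm y) := by
  rw [fieldIn, VectorField.mpullback_apply, ← coe_symmDeriv he hy]
  erw [ContinuousLinearMap.inverse_equiv]
  exact (symmDeriv he hy).apply_symm_apply _

/-- The vector field whose expression in the chart `e` is `η`. -/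
def frameField (e : ChartOf n M) (η : EuclideanSpace ℝ (Fin n) → EuclideanSpace ℝ (Fin n)) :
    VField n M :=
  VectorField.mpullback (𝓡 n) (𝓡 n) e (fun y => (η y : TangentSpace (𝓡 n) y))

theorem frameField_symm (he : e ∈ IsManifold.maximalAtlas (𝓡 n) ∞ M) (hy : y ∈ e.target)
    (η : EuclideanSpace ℝ (Fin n) → EuclideanSpace ℝ (Fin n)) :
    frameField e η (e.symm y) = symmDeriv he hy (η y) := by
  have hx := e.map_target hy
  have h1 : ((((mdifferentiable_of_mem_maximalAtlas he).mfderiv hx) :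
      TangentSpace (𝓡 n) (e.symm y) →L[ℝ] TangentSpace (𝓡 n) (e (e.symm y))))
      = mfderiv (𝓡 n) (𝓡 n) e (e.symm y) := rfl
  change (mfderiv (𝓡 n) (𝓡 n) e (e.symm y)).inverse (η (e (e.symm y))) = _
  rw [← h1, ContinuousLinearMap.inverse_equiv]
  change mfderiv (𝓡 n) (𝓡 n) e.symm (e (e.symm y)) (η (e (e.symm y))) = _
  rw [e.right_inv hy]
  rfl

theorem contDiffAt_transition (he : e ∈ IsManifold.maximalAtlas (𝓡 n) ∞ M)
    (he' : e' ∈ IsManifold.maximalAtlas (𝓡 n) ∞ M) (hy : y ∈ e'.target)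
    (hy' : e'.symm y ∈ e.source) : ContDiffAt ℝ ∞ (e ∘ e'.symm) y :=
  contMDiffAt_iff_contDiffAt.1 ((contMDiffAt_of_mem_maximalAtlas he hy').comp y
    (contMDiffAt_symm_of_mem_maximalAtlas he' hy))

theorem symmDeriv_transition (he : e ∈ IsManifold.maximalAtlas (𝓡 n) ∞ M)
    (he' : e' ∈ IsManifold.maximalAtlas (𝓡 n) ∞ M) (hy : y ∈ e'.target)
    (hy' : e'.symm y ∈ e.source) (u : EuclideanSpace ℝ (Fin n)) :
    (symmDeriv he (e.map_source hy') (fderiv ℝ (e ∘ e'.symm) y u) : EuclideanSpace ℝ (Fin n))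
      = symmDeriv he' hy u := by
  have d := mdifferentiable_of_mem_maximalAtlas he
  have d' := mdifferentiable_of_mem_maximalAtlas he'
  have h1 : mfderiv (𝓡 n) (𝓡 n) (e ∘ e'.symm) y
      = (mfderiv (𝓡 n) (𝓡 n) e (e'.symm y)).comp (mfderiv (𝓡 n) (𝓡 n) e'.symm y) :=
    mfderiv_comp y (d.mdifferentiableAt hy') (d'.mdifferentiableAt_symm hy)
  have h2 := d.symm_comp_deriv hy'
  rw [← mfderiv_eq_fderiv]
  change mfderiv (𝓡 n) (𝓡 n) e.symm (e (e'.symm y)) (mfderiv (𝓡 n) (𝓡 n) (e ∘ e'.symm) y u) = _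
  rw [h1]
  exact congrArg (fun l => l (mfderiv (𝓡 n) (𝓡 n) e'.symm y u)) h2

theorem fieldIn_transition (he : e ∈ IsManifold.maximalAtlas (𝓡 n) ∞ M)
    (he' : e' ∈ IsManifold.maximalAtlas (𝓡 n) ∞ M) (hy : y ∈ e'.target)
    (hy' : e'.symm y ∈ e.source) (ξ : VField n M) :
    fderiv ℝ (e ∘ e'.symm) y (fieldIn e' ξ y) = fieldIn e ξ ((e ∘ e'.symm) y) := by
  -- The base points e⁻¹(e(x)) and x agree only propositionally, so the two tangent vectors are
  -- compared in the model space.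
  have key : ∀ (x x' : M), x = x' → (ξ x : EuclideanSpace ℝ (Fin n)) = ξ x' := by
    rintro x _ rfl; rfl
  apply (symmDeriv he (e.map_source hy')).injective
  refine (symmDeriv_transition he he' hy hy' _).trans ?_
  refine (symmDeriv_fieldIn he' hy ξ).trans ?_
  refine Eq.trans ?_ (symmDeriv_fieldIn he (e.map_source hy') ξ).symm
  exact key _ _ (e.left_inv hy').symm

variable [IsManifold (𝓡 n) ∞ M]

theorem metricIn_apply (he : e ∈ IsManifold.maximalAtlas (𝓡 n) ∞ M) (hy : y ∈ e.target)
    (h : RMetric n M) (u v : EuclideanSpace ℝ (Fin n)) :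
    metricIn e h y u v = h.inner (e.symm y) (symmDeriv he hy u) (symmDeriv he hy v) := rfl

theorem contDiffAt_fieldIn (he : e ∈ IsManifold.maximalAtlas (𝓡 n) ∞ M) (hy : y ∈ e.target)
    {U : Set M} (hU : IsOpen U) (hyU : e.symm y ∈ U) {ξ : VField n M} (hξ : IsSmoothField U ξ) :
    ContDiffAt ℝ ∞ (fieldIn e ξ) y := by
  refine contMDiffAt_vectorSpace_iff_contDiffAt.1 ?_
  refine ContMDiffAt.mpullback_vectorField_preimage (n := ∞)
    ((hξ _ hyU).contMDiffAt (hU.mem_nhds hyU)) (contMDiffAt_symm_of_mem_maximalAtlas he hy) ?_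
    (by simp)
  exact ⟨symmDeriv he hy, rfl⟩

theorem contMDiffAt_frameField (he : e ∈ IsManifold.maximalAtlas (𝓡 n) ∞ M)
    {x : M} (hx : x ∈ e.source) {η : EuclideanSpace ℝ (Fin n) → EuclideanSpace ℝ (Fin n)}
    (hη : ContDiffAt ℝ ∞ η (e x)) :
    ContMDiffAt (𝓡 n) ((𝓡 n).prod (𝓡 n)) ∞
      (fun x => (⟨x, frameField e η x⟩ : Bundle.TotalSpace (EuclideanSpace ℝ (Fin n))
        (fun x : M => TangentSpace (𝓡 n) x))) x := by
  refine ContMDiffAt.mpullback_vectorField_preimage (n := ∞)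
    (contMDiffAt_vectorSpace_iff_contDiffAt.2 hη) (contMDiffAt_of_mem_maximalAtlas he hx) ?_
    (by simp)
  exact ⟨(mdifferentiable_of_mem_maximalAtlas he).mfderiv hx, rfl⟩

/-- In finite dimension smoothness can be tested on each constant vector `u`. The resulting function
is the chart expression of θ paired with the frame field of `u`, which is smooth on M. -/
theorem contDiffAt_formIn (he : e ∈ IsManifold.maximalAtlas (𝓡 n) ∞ M) (hy : y ∈ e.target)
    {θ : OneForm n M}
    (hθ : ContMDiff (𝓡 n) ((𝓡 n).prod 𝓘(ℝ, EuclideanSpace ℝ (Fin n) →L[ℝ] ℝ)) ∞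
      (fun x => (⟨x, θ x⟩ : Bundle.TotalSpace (EuclideanSpace ℝ (Fin n) →L[ℝ] ℝ)
        (fun x : M => TangentSpace (𝓡 n) x →L[ℝ] ℝ)))) :
    ContDiffAt ℝ ∞ (formIn e θ) y := by
  have key : ContDiffOn ℝ ∞ (formIn e θ) e.target := by
    rw [contDiffOn_clm_apply]
    intro u z hz
    have h1 := (hθ (e.symm z)).clm_bundle_apply (F₂ := ℝ) (E₂ := Bundle.Trivial M ℝ)
      (contMDiffAt_frameField he (e.map_target hz) (contDiffAt_const (c := u)))
    have h2 : ContMDiffAt (𝓡 n) 𝓘(ℝ, ℝ) ∞ (fun x => θ x (frameField e (fun _ => u) x))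
        (e.symm z) := by
      simpa [Bundle.contMDiffAt_section] using h1
    have h3 := h2.comp z (contMDiffAt_symm_of_mem_maximalAtlas he hz)
    refine (contMDiffAt_iff_contDiffAt.1 h3).contDiffWithinAt.congr_of_eventuallyEq
      (Filter.eventually_of_mem self_mem_nhdsWithin fun w hw => ?_) ?_
    · change _ = θ (e.symm w) (frameField e (fun _ => u) (e.symm w))
      rw [frameField_symm he hw]; rfl
    · change _ = θ (e.symm z) (frameField e (fun _ => u) (e.symm z))
      rw [frameField_symm he hz]; rfl
  exact key.contDiffAt (e.open_target.mem_nhds hy)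

theorem contDiffAt_metricIn (he : e ∈ IsManifold.maximalAtlas (𝓡 n) ∞ M) (hy : y ∈ e.target)
    (h : RMetric n M) : ContDiffAt ℝ ∞ (metricIn e h) y := by
  have key : ContDiffOn ℝ ∞ (metricIn e h) e.target := by
    rw [contDiffOn_clm_apply]
    intro u
    rw [contDiffOn_clm_apply]
    intro v z hz
    have h1 := ContMDiffAt.clm_bundle_apply₂ (F₃ := ℝ) (E₃ := Bundle.Trivial M ℝ)
      (h.contMDiff (e.symm z))
      (contMDiffAt_frameField he (e.map_target hz) (contDiffAt_const (c := u)))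
      (contMDiffAt_frameField he (e.map_target hz) (contDiffAt_const (c := v)))
    have h2 : ContMDiffAt (𝓡 n) 𝓘(ℝ, ℝ) ∞ (fun x => h.inner x (frameField e (fun _ => u) x)
        (frameField e (fun _ => v) x)) (e.symm z) := by
      simpa [Bundle.contMDiffAt_section] using h1
    have h3 := h2.comp z (contMDiffAt_symm_of_mem_maximalAtlas he hz)
    refine (contMDiffAt_iff_contDiffAt.1 h3).contDiffWithinAt.congr_of_eventuallyEq
      (Filter.eventually_of_mem self_mem_nhdsWithin fun w hw => ?_) ?_
    · change _ = h.inner (e.symm w) (frameField e (fun _ => u) (e.symm w))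
        (frameField e (fun _ => v) (e.symm w))
      rw [frameField_symm he hw, frameField_symm he hw]; rfl
    · change _ = h.inner (e.symm z) (frameField e (fun _ => u) (e.symm z))
        (frameField e (fun _ => v) (e.symm z))
      rw [frameField_symm he hz, frameField_symm he hz]; rfl
  exact key.contDiffAt (e.open_target.mem_nhds hy)

theorem isMetricOn_metricIn (he : e ∈ IsManifold.maximalAtlas (𝓡 n) ∞ M) (h : RMetric n M) :
    Coord.IsMetricOn (metricIn e h) e.target where
  isOpen := e.open_target
  smooth y hy := contDiffAt_metricIn he hy h
  symm y hy u v := by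
    rw [metricIn_apply he hy, metricIn_apply he hy]
    exact h.symm _ _ _
  pos y hy u hu := by
    rw [metricIn_apply he hy]
    exact h.pos _ _ fun h0 => hu ((symmDeriv he hy).injective (h0.trans (map_zero _).symm))

theorem metricIn_transition (he : e ∈ IsManifold.maximalAtlas (𝓡 n) ∞ M)
    (he' : e' ∈ IsManifold.maximalAtlas (𝓡 n) ∞ M) (hy : y ∈ e'.target)
    (hy' : e'.symm y ∈ e.source) (h : RMetric n M) (u v : EuclideanSpace ℝ (Fin n)) :
    metricIn e' h y u v = metricIn e h ((e ∘ e'.symm) y) (fderiv ℝ (e ∘ e'.symm) y u)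
      (fderiv ℝ (e ∘ e'.symm) y v) := by
  have key : ∀ (x x' : M), x = x' → ∀ a b : EuclideanSpace ℝ (Fin n),
      h.inner x a b = h.inner x' a b := by
    rintro x _ rfl a b; rfl
  rw [metricIn_apply he' hy]
  change _ = h.inner (e.symm (e (e'.symm y))) (symmDeriv he (e.map_source hy') _)
    (symmDeriv he (e.map_source hy') _)
  erw [symmDeriv_transition he he' hy hy' u, symmDeriv_transition he he' hy hy' v]
  exact key _ _ (e.left_inv hy').symm _ _

end Manifold

/-! ### From the manifold to a chart and back -/

section Manifold

variable {n : ℕ} {M : Type*} [TopologicalSpace M] [ChartedSpace (EuclideanSpace ℝ (Fin n)) M]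
  [IsManifold (𝓡 n) ∞ M] {e e' : ChartOf n M} {y : EuclideanSpace ℝ (Fin n)}
  {U : Set M} {ξ : VField n M}

theorem IsKilling.isKillingOn (he : e ∈ IsManifold.maximalAtlas (𝓡 n) ∞ M) {h : RMetric n M}
    (hU : IsOpen U) (K : IsKilling h U ξ) :
    Coord.IsKillingOn (metricIn e h) (e.target ∩ e.symm ⁻¹' U) (fieldIn e ξ) := by
  refine ⟨fun y hy => contDiffAt_fieldIn he hy.1 hU hy.2 K.1, fun y hy u v => ?_⟩
  have := K.2 e he y hy.1 hy.2 u v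
  rwa [Coord.lie₂, Coord.fderiv_clm_apply₂_const
    (Coord.differentiableAt_of_smooth (contDiffAt_metricIn he hy.1 h))] at this

/-- The definition asks for the Killing equation in every smooth chart; a single chart containing
`U` is enough, by `Coord.lie_metric_of_pullback` applied to the transition maps. -/
theorem isKilling_of_isKillingOn (he : e ∈ IsManifold.maximalAtlas (𝓡 n) ∞ M) {h : RMetric n M}
    (hU : IsOpen U) (hUe : U ⊆ e.source) (hξ : IsSmoothField U ξ)
    (K : Coord.IsKillingOn (metricIn e h) (e.target ∩ e.symm ⁻¹' U) (fieldIn e ξ)) :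
    IsKilling h U ξ := by
  refine ⟨hξ, fun e' he' y hy hyU u v => ?_⟩
  have hO := e'.isOpen_inter_preimage_symm hU
  have hyO : y ∈ e'.target ∩ e'.symm ⁻¹' U := ⟨hy, hyU⟩
  have hτ : (e ∘ e'.symm) y ∈ e.target := e.map_source (hUe hyU)
  have hτU : e.symm ((e ∘ e'.symm) y) ∈ U := by
    rw [Function.comp_apply, e.left_inv (hUe hyU)]; exact hyU
  rw [Coord.lie₂, Coord.fderiv_clm_apply₂_const
    (Coord.differentiableAt_of_smooth (contDiffAt_metricIn he' hy h)),
    Coord.lie_metric_of_pullback (contDiffAt_transition he he' hy (hUe hyU))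
      (contDiffAt_metricIn he hτ h) (K.smooth _ ⟨hτ, hτU⟩) (contDiffAt_metricIn he' hy h)
      (contDiffAt_fieldIn he' hy hU hyU hξ)
      (Filter.eventually_of_mem (hO.mem_nhds hyO) fun z hz =>
        metricIn_transition he he' hz.1 (hUe hz.2) h)
      (Filter.eventually_of_mem (hO.mem_nhds hyO) fun z hz =>
        fieldIn_transition he he' hz.1 (hUe hz.2) ξ)]
  exact K.lie _ ⟨hτ, hτU⟩ _ _

/-! ### Symmetries and iterated Lie derivatives of W in a chart -/

namespace KundtTriple

variable (T : KundtTriple n M) (σ : ℝ)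

theorem contDiffAt_formIn_W (he : e ∈ IsManifold.maximalAtlas (𝓡 n) ∞ M) :
    ∀ y ∈ e.target, ContDiffAt ℝ ∞ (formIn e T.W) y :=
  fun _ hy => contDiffAt_formIn he hy T.smooth_W

variable {T σ}

theorem IsSymmetry.isSymmetryOn (he : e ∈ IsManifold.maximalAtlas (𝓡 n) ∞ M) (hU : IsOpen U)
    (S : T.IsSymmetry σ U ξ) :
    Coord.IsSymmetryOn (metricIn e T.h) (formIn e T.W) σ (e.target ∩ e.symm ⁻¹' U)
      (fieldIn e ξ) := by
  have H := (isMetricOn_metricIn he T.h).mono (e.isOpen_inter_preimage_symm hU) inter_subset_left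
  exact Coord.isSymmetryOn_of_lie H (fun y hy => T.contDiffAt_formIn_W he y hy.1)
    (S.1.isKillingOn he hU) (fun y hy => (S.2 e he y hy.1 hy.2).1)
    (fun y hy => (S.2 e he y hy.1 hy.2).2.1) (fun y hy => (S.2 e he y hy.1 hy.2).2.2.1)
    (fun y hy => (S.2 e he y hy.1 hy.2).2.2.2)

theorem isIterLie_formIn (he : e ∈ IsManifold.maximalAtlas (𝓡 n) ∞ M) (hU : IsOpen U) (k : ℕ) :
    ∀ v ∈ T.iterLie σ U (k + 1),
      Coord.IsIterLie (metricIn e T.h) (formIn e T.W) σ (e.target ∩ e.symm ⁻¹' U)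
        (formIn e v) := by
  have hW : ∀ y ∈ e.target ∩ e.symm ⁻¹' U, ContDiffAt ℝ ∞ (formIn e T.W) y := fun y hy =>
    T.contDiffAt_formIn_W he y hy.1
  have hO := e.isOpen_inter_preimage_symm hU
  induction k with
  | zero =>
    rintro v ⟨w, hw, ξ, hξ, hv⟩
    obtain rfl : w = T.W := hw
    refine .base (hξ.isSymmetryOn he hU) fun y hy => ?_
    ext u
    rw [hv e he y hy.1 hy.2 u, Coord.lie₁_eq_lieForm (hW y hy)]
  | succ k ih =>
    rintro v ⟨w, hw, ξ, hξ, hv⟩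
    have hw' := ih w hw
    refine .step hw' (hξ.isSymmetryOn he hU) fun y hy => ?_
    ext u
    rw [hv e he y hy.1 hy.2 u, Coord.lie₁_eq_lieForm (hw'.smooth hO hW y hy)]

/-- Dimension n forces `lieSpan` to be the whole cotangent space. Pulling covectors back by the
derivative of the inverse chart is an isomorphism that carries its generators to coordinate iterated
Lie derivatives. -/
theorem span_iterValues (he : e ∈ IsManifold.maximalAtlas (𝓡 n) ∞ M)
    (hdim : ∀ p : M, finrank ℝ (T.lieSpan σ p) = n) (hy : y ∈ e.target) :
    Submodule.span ℝ
      (Coord.iterValues (metricIn e T.h) (formIn e T.W) σ e.target y) = ⊤ := by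
  have htop : T.lieSpan σ (e.symm y) = ⊤ := by
    have : FiniteDimensional ℝ (TangentSpace (𝓡 n) (e.symm y) →L[ℝ] ℝ) :=
      inferInstanceAs (FiniteDimensional ℝ (EuclideanSpace ℝ (Fin n) →L[ℝ] ℝ))
    refine Submodule.eq_top_of_finrank_eq ?_
    rw [hdim]
    change n = finrank ℝ (EuclideanSpace ℝ (Fin n) →L[ℝ] ℝ)
    rw [← (LinearMap.toContinuousLinearMap : (EuclideanSpace ℝ (Fin n) →ₗ[ℝ] ℝ) ≃ₗ[ℝ] _).finrank_eq]
    exact (finrank_euclideanSpace_fin (𝕜 := ℝ)).symm.trans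
      (Subspace.dual_finrank_eq (K := ℝ) (V := EuclideanSpace ℝ (Fin n))).symm
  let S := symmDeriv he hy
  have key : ∀ θ ∈ T.lieSpan σ (e.symm y),
      θ.comp (S : EuclideanSpace ℝ (Fin n) →L[ℝ] TangentSpace (𝓡 n) (e.symm y)) ∈
        Submodule.span ℝ
          (Coord.iterValues (metricIn e T.h) (formIn e T.W) σ e.target y) := by
    intro θ hθ
    induction hθ using Submodule.span_induction with
    | mem θ hθ =>
      obtain ⟨U, hU, hyU, k, v, hv, rfl⟩ := hθ
      exact Submodule.subset_span ⟨_, e.isOpen_inter_preimage_symm hU, ⟨hy, hyU⟩,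
        inter_subset_left, _, isIterLie_formIn he hU k v hv, rfl⟩
    | zero => rw [ContinuousLinearMap.zero_comp]; exact Submodule.zero_mem _
    | add θ₁ θ₂ _ _ h₁ h₂ => rw [ContinuousLinearMap.add_comp]; exact Submodule.add_mem _ h₁ h₂
    | smul c θ _ hc => rw [ContinuousLinearMap.smul_comp]; exact Submodule.smul_mem _ c hc
  refine eq_top_iff.2 fun φ _ => ?_
  have h1 := key (φ.comp (S.symm : TangentSpace (𝓡 n) (e.symm y) →L[ℝ] EuclideanSpace ℝ (Fin n)))
    (htop ▸ Submodule.mem_top)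
  convert h1
  ext u
  exact congrArg φ (S.symm_apply_apply u).symm

end KundtTriple

/-! ### Killing fields on the image of a coordinate set and their dimension -/

open scoped Classical in
/-- The vector field on `M` given by `η` on the image of `B` in the chart `e`, and zero
elsewhere. -/
def extendField (e : ChartOf n M) (B : Set (EuclideanSpace ℝ (Fin n))) :
    (EuclideanSpace ℝ (Fin n) → EuclideanSpace ℝ (Fin n)) →ₗ[ℝ] VField n M where
  toFun η x := if x ∈ e.symm '' B then frameField e η x else 0
  map_add' η η' := by
    funext x
    change (if x ∈ e.symm '' B then frameField e (η + η') x else 0)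
      = (if x ∈ e.symm '' B then frameField e η x else 0)
        + (if x ∈ e.symm '' B then frameField e η' x else 0)
    split_ifs
    · exact map_add (mfderiv (𝓡 n) (𝓡 n) e x).inverse (η (e x)) (η' (e x))
    · exact (add_zero _).symm
  map_smul' c η := by
    funext x
    change (if x ∈ e.symm '' B then frameField e (c • η) x else 0)
      = c • (if x ∈ e.symm '' B then frameField e η x else 0)
    split_ifs
    · exact map_smul (mfderiv (𝓡 n) (𝓡 n) e x).inverse c (η (e x))
    · exact (smul_zero _).symm

variable {B : Set (EuclideanSpace ℝ (Fin n))} {h : RMetric n M}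

omit [IsManifold (𝓡 n) ∞ M] in
theorem extendField_symm (he : e ∈ IsManifold.maximalAtlas (𝓡 n) ∞ M) (hBe : B ⊆ e.target)
    (η : EuclideanSpace ℝ (Fin n) → EuclideanSpace ℝ (Fin n)) (hy : y ∈ B) :
    extendField e B η (e.symm y) = symmDeriv he (hBe hy) (η y) := by
  rw [← frameField_symm he (hBe hy)]
  exact if_pos (mem_image_of_mem _ hy)

omit [IsManifold (𝓡 n) ∞ M] in
theorem fieldIn_extendField (he : e ∈ IsManifold.maximalAtlas (𝓡 n) ∞ M) (hBe : B ⊆ e.target)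
    (η : EuclideanSpace ℝ (Fin n) → EuclideanSpace ℝ (Fin n)) (hy : y ∈ B) :
    fieldIn e (extendField e B η) y = η y :=
  (symmDeriv he (hBe hy)).injective <| by
    rw [symmDeriv_fieldIn, extendField_symm he hBe η hy]

omit [ChartedSpace (EuclideanSpace ℝ (Fin n)) M] [IsManifold (𝓡 n) ∞ M] in
theorem target_inter_preimage_image (hBe : B ⊆ e.target) :
    e.target ∩ e.symm ⁻¹' (e.symm '' B) = B := by
  ext z
  refine ⟨?_, fun hz => ⟨hBe hz, mem_image_of_mem _ hz⟩⟩
  rintro ⟨hz, w, hw, hwz⟩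
  exact e.symm.injOn (hBe hw) hz hwz ▸ hw

theorem extendField_isKilling (he : e ∈ IsManifold.maximalAtlas (𝓡 n) ∞ M) (hB : IsOpen B)
    (hBe : B ⊆ e.target) {η : EuclideanSpace ℝ (Fin n) → EuclideanSpace ℝ (Fin n)}
    (hη : Coord.IsKillingOn (metricIn e h) B η) :
    IsKilling h (e.symm '' B) (extendField e B η) := by
  have hU : IsOpen (e.symm '' B) := e.symm.isOpen_image_of_subset_source hB hBe
  have hUe : e.symm '' B ⊆ e.source := by
    rintro _ ⟨z, hz, rfl⟩; exact e.map_target (hBe hz)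
  refine isKilling_of_isKillingOn he hU hUe ?_ ?_
  · rintro _ ⟨z, hz, rfl⟩
    have hη' : ContDiffAt ℝ ∞ η (e (e.symm z)) := by
      rw [e.right_inv (hBe hz)]; exact hη.smooth z hz
    refine ((contMDiffAt_frameField he (e.map_target (hBe hz)) hη').congr_of_eventuallyEq
      (Filter.eventually_of_mem (hU.mem_nhds (mem_image_of_mem _ hz)) fun x hx => ?_)).contMDiffWithinAt
    exact congrArg (Bundle.TotalSpace.mk x) (if_pos hx)
  · rw [target_inter_preimage_image hBe]
    exact hη.congr hB fun z hz => fieldIn_extendField he hBe η hz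

open scoped Classical in
-- Besides matching the fields on M with coordinate fields, this shows that the set is already a
-- subspace, so taking its span does not enlarge it.
theorem killing_eq_range (he : e ∈ IsManifold.maximalAtlas (𝓡 n) ∞ M) (hB : IsOpen B)
    (hBe : B ⊆ e.target) :
    {ξ : VField n M | IsKilling h (e.symm '' B) ξ ∧ ∀ x, x ∉ e.symm '' B → ξ x = 0}
      = LinearMap.range
        ((extendField e B).comp (Coord.killingSpace (metricIn e h) B).subtype) := by
  have hU : IsOpen (e.symm '' B) := e.symm.isOpen_image_of_subset_source hB hBe
  ext ξ
  constructor
  · rintro ⟨K, h0⟩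
    have hK := K.isKillingOn he hU
    rw [target_inter_preimage_image hBe] at hK
    refine ⟨⟨fun y => if y ∈ B then fieldIn e ξ y else 0,
      hK.congr hB fun y hy => if_pos hy, fun y hy => if_neg hy⟩, ?_⟩
    funext x
    by_cases hx : x ∈ e.symm '' B
    · obtain ⟨z, hz, rfl⟩ := hx
      refine (extendField_symm he hBe _ hz).trans ?_
      change symmDeriv he (hBe hz) (if z ∈ B then fieldIn e ξ z else 0) = _
      rw [if_pos hz, symmDeriv_fieldIn]
    · exact (if_neg hx).trans (h0 x hx).symm
  · rintro ⟨η, rfl⟩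
    exact ⟨extendField_isKilling he hB hBe η.2.1, fun x hx => if_neg hx⟩

theorem finrank_killing (he : e ∈ IsManifold.maximalAtlas (𝓡 n) ∞ M) (hB : IsOpen B)
    (hBe : B ⊆ e.target) :
    finrank ℝ (Submodule.span ℝ
      {ξ : VField n M | IsKilling h (e.symm '' B) ξ ∧ ∀ x, x ∉ e.symm '' B → ξ x = 0})
      = finrank ℝ (Coord.killingSpace (metricIn e h) B) := by
  rw [killing_eq_range he hB hBe, Submodule.span_eq]
  refine LinearMap.finrank_range_of_inj ?_
  rw [injective_iff_map_eq_zero]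
  intro η hη
  ext1
  funext y
  by_cases hy : y ∈ B
  · have h1 := fieldIn_extendField he hBe η.1 hy
    have h2 : extendField e B η.1 = 0 := hη
    rw [← h1, h2]
    exact map_zero _
  · exact η.2.2 y hy

end Manifold

end

theorem mainTheorem7 (n : ℕ) (M : Type*) [TopologicalSpace M]
    [ChartedSpace (EuclideanSpace ℝ (Fin n)) M] [IsManifold (𝓡 n) ∞ M]
    (T : KundtTriple n M) (σ : ℝ) (hT : T.IsCSI σ)
    (hdim : ∀ p : M, finrank ℝ (T.lieSpan σ p) = n) :
    (InCharts (univ : Set M) fun e y => ∀ u v,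
      Coord.sTensor (metricIn e T.h) (formIn e T.W) y u v = 2 * σ * metricIn e T.h y u v ∧
      Coord.aTensor (metricIn e T.h) (formIn e T.W) y u v = 0) ∧
    IsLocallyMaximallySymmetric T.h ∧
    (InCharts (univ : Set M) fun e y => ∀ a b c d,
      Coord.riemann (metricIn e T.h) y a b c d =
        σ * (metricIn e T.h y a c * metricIn e T.h y b d
          - metricIn e T.h y a d * metricIn e T.h y b c)) := by
  refine ⟨fun e he y hy _ u v => ?_, fun p => ?_, fun e he y hy _ a b c d => ?_⟩
  · have H := isMetricOn_metricIn he T.h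
    have hW := T.contDiffAt_formIn_W he
    have hs := Coord.tTensor_eq_of_span H hW hy (T.span_iterValues he hdim hy)
    rw [Coord.sTensor_eq H (hW y hy) hy, Coord.aTensor_eq H (hW y hy) hy, hs, hs, H.symm y hy v u]
    constructor <;> ring
  · let e : ChartOf n M := chartAt (EuclideanSpace ℝ (Fin n)) p
    have he : e ∈ IsManifold.maximalAtlas (𝓡 n) ∞ M := IsManifold.chart_mem_maximalAtlas p
    have hpe : p ∈ e.source := mem_chart_source _ p
    have H := isMetricOn_metricIn he T.h
    obtain ⟨r, hr, hrs, hsol⟩ := Coord.exists_sol H (T.contDiffAt_formIn_W he)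
      (fun y hy => T.span_iterValues he hdim hy) (e.map_source hpe)
    have hB : IsOpen (Metric.ball (e p) r) := Metric.isOpen_ball
    -- The neighbourhood is the image of a coordinate ball: convexity of the ball gives
    -- connectedness here and the rigidity used in the dimension count.
    refine ⟨e.symm '' Metric.ball (e p) r, e.symm.isOpen_image_of_subset_source hB hrs,
      ⟨e p, Metric.mem_ball_self hr, e.left_inv hpe⟩, ?_, ?_⟩
    · exact ((convex_ball (e p) r).isConnected ⟨e p, Metric.mem_ball_self hr⟩).image _
        (e.continuousOn_symm.mono hrs)
    · rw [finrank_killing he hB hrs]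
      exact Coord.finrank_killingSpace (EuclideanSpace.basisFun (Fin n) ℝ).toBasis
        (H.mono hB hrs) (convex_ball _ _) (Metric.mem_ball_self hr) hsol
  · exact Coord.curvature_of_span (isMetricOn_metricIn he T.h) (T.contDiffAt_formIn_W he) hy
      (T.span_iterValues he hdim hy) a b c d
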